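/- Let $w$ be a strictly positive real-analytic weight on the unit circle $\mathbb T_1$, and let $\Phi_n$ be the monic polynomial of degree $n$ with $\oint_{\mathbb T_1}\Phi_n(z)\,\overline{z^k}\,w(z)\,|dz|=0$ for $0\le k<n$. Let $$D(w;z)=\exp\Big(\frac1{4\pi}\int_0^{2\pi}\log w(e^{i\theta})\,\frac{e^{i\theta}+z}{e^{i\theta}-z}\,d\theta\Big),\qquad |z|\ne1,$$ be the Szegő function, $D_{\rm i}$ and $D_{\rm e}$ its restrictions to $|z|<1$ and $|z|>1$ (and $D_{\rm e}$ also the analytic continuation of the latter), $D_{\rm e}(\infty)=\lim_{z\to\infty}D_{\rm e}(z)$, $\mathcal S=D_{\rm i}D_{\rm e}$, and $$\rho=\inf\{0<r<1:\ D_{\rm e}\text{ extends holomorphically to }|z|>r\}.$$ Assume that for some $0\le\rho'<\rho$ the function $D_{\rm e}$ continues analytically to $\{|z|>\rho'\}\setminus\{a_1,\dots,a_u\}$, where $a_1,\dots,a_u$ are finitely many distinct points with $|a_k|=\rho$. Fix $r$ with $\rho<r<1$, and put $$R_n(z)=\frac{D_{\rm i}(0)}{D_{\rm i}(z)}\sum_{k=1}^u\operatorname*{res}_{t=a_k}\Big(\mathcal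 S(t)\,\frac{t^n}{t-z}\Big).$$ (a) Let $\rho<r'<r$. For every $s>\rho'$ there are constants $0\le\delta<1$ and $C<\infty$ (depending on $r'$ and $s$, but not on $n$ or $z$) such that for all integers $n\ge0$ and all $z\notin\{a_1,\dots,a_u\}$ with $s\le|z|\le r'$, $$\Big|\Phi_n(z)-z^n\frac{D_{\rm e}(z)}{D_{\rm e}(\infty)}-R_n(z)\Big|\le C\,(\rho^n\delta^n+r^{3n}).$$ If moreover $D_{\rm e}$ is bounded on $\rho'<|z|<s_0$ for some $s_0>\rho'$, then there are constants $0\le\delta<1$ and $C<\infty$ (depending on $r'$ only) such that this estimate holds for all $n\ge0$ and all $z\notin\{a_1,\dots,a_u\}$ with $\rho'<|z|\le r'$. (b) For every compact set $K\subset\{|z|<\rho\}$ there are constants $0\le\delta<1$ and $C<\infty$ such that for all $n\ge0$ and all $z\in K$, $$|\Phi_n(z)-R_n(z)|\le C\,(\rho^n\delta^n+r^{3n}).$$ -/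

import Mathlib

open Filter Topology Polynomial ComplexConjugate

noncomputable section

namespace Szego

/-- A strictly positive real-analytic weight on the unit circle. -/
structure IsAnalyticWeight (w : Circle → ℝ) : Prop where
  pos : ∀ ζ, 0 < w ζ
  analytic : AnalyticOnNhd ℝ (fun θ : ℝ => w (Circle.exp θ)) Set.univ

/-- The sesquilinear form `∮ P(z) conj(Q(z)) w(z) |dz|` over the unit circle. -/
def opucInner (w : Circle → ℝ) (P Q : ℂ[X]) : ℂ :=
  ∫ θ in (0 : ℝ)..2 * Real.pi,
    P.eval (Circle.exp θ : ℂ) * conj (Q.eval (Circle.exp θ : ℂ)) * (w (Circle.exp θ) : ℂ)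

/-- The monic orthogonal polynomials `Φ_n` of the weight `w`, by the Gram-Schmidt process applied
to `1, z, z^2, …`. See `monicOPUC_monic`, `natDegree_monicOPUC`, `opucInner_monicOPUC` and
`eq_monicOPUC` for the characterization. -/
def monicOPUC (w : Circle → ℝ) (n : ℕ) : ℂ[X] :=
  X ^ n - ∑ k : Fin n,
    C (opucInner w (X ^ n) (monicOPUC w k) / opucInner w (monicOPUC w k) (monicOPUC w k)) *
      monicOPUC w k
termination_by n
decreasing_by exact k.2

/-- The Szegő function
`D(w; z) = exp ((1/4π) ∫_0^{2π} log w(e^{iθ}) (e^{iθ} + z)/(e^{iθ} - z) dθ)`, for `|z| ≠ 1`.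
Its restriction to `|z| < 1` is `D_i`, its restriction to `|z| > 1` is `D_e`. -/
def szegoFunction (w : Circle → ℝ) (z : ℂ) : ℂ :=
  Complex.exp (1 / (4 * Real.pi) * ∫ θ in (0 : ℝ)..2 * Real.pi,
    (Real.log (w (Circle.exp θ)) : ℂ) *
      (((Circle.exp θ : ℂ) + z) / ((Circle.exp θ : ℂ) - z)))

/-- The value `D_e(w; ∞)`; see `tendsto_szegoFunction_cobounded`. -/
def szegoAtInfty (w : Circle → ℝ) : ℂ :=
  Complex.exp (-(1 / (4 * Real.pi) * ∫ θ in (0 : ℝ)..2 * Real.pi,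
    (Real.log (w (Circle.exp θ)) : ℂ)))

/-- `De` is an analytic continuation of the exterior Szegő function `D_e(w; ·)` to the open set
`U` (which in all uses contains `|z| > 1`). -/
structure IsExteriorContinuation (w : Circle → ℝ) (De : ℂ → ℂ) (U : Set ℂ) : Prop where
  differentiableOn : DifferentiableOn ℂ De U
  eq_szego : ∀ z : ℂ, 1 < ‖z‖ → De z = szegoFunction w z

/-- The critical radius
`ρ = inf {0 < r < 1 : D_e(w; ·) is holomorphic in |z| > r}`. -/
def criticalRadius (w : Circle → ℝ) : ℝ :=
  sInf {r : ℝ | 0 < r ∧ r < 1 ∧ ∃ F : ℂ → ℂ, IsExteriorContinuation w F {z : ℂ | r < ‖z‖}}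

/-- The scattering function `𝒮 = D_i D_e` inside the unit disc, where `De` is the continuation
of `D_e`. -/
def scattering (w : Circle → ℝ) (De : ℂ → ℂ) (t : ℂ) : ℂ :=
  szegoFunction w t * De t

/-- The residue of `f` at an isolated singularity `a`: the (eventually constant) limit as
`ε → 0+` of `(1/2πi) ∮_{|t - a| = ε} f(t) dt`. -/
def residue (f : ℂ → ℂ) (a : ℂ) : ℂ :=
  limUnder (𝓝[>] (0 : ℝ))
    (fun ε : ℝ => (2 * Real.pi * Complex.I)⁻¹ * ∮ t in C(a, ε), f t)

/-- `(D_i(0) / D_i(z)) * ∑_{a ∈ A} res_{t = a} (𝒮(t) t^n / (t - z))`. -/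
def residueTerm (w : Circle → ℝ) (De : ℂ → ℂ) (A : Finset ℂ) (n : ℕ) (z : ℂ) : ℂ :=
  szegoFunction w 0 / szegoFunction w z *
    ∑ a ∈ A, residue (fun t => scattering w De t * (t ^ n / (t - z))) a

/-! ### The definitions agree with the usual characterizations -/

theorem degree_sum_lt (n : ℕ) (c : Fin n → ℂ) (p : Fin n → ℂ[X])
    (hp : ∀ k : Fin n, (p k).degree = ((k : ℕ) : WithBot ℕ)) :
    (∑ k : Fin n, C (c k) * p k).degree < (n : WithBot ℕ) := by
  refine lt_of_le_of_lt (degree_sum_le _ _) ?_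
  refine (Finset.sup_lt_iff (WithBot.bot_lt_coe n)).2 ?_
  intro k _
  rw [← smul_eq_C_mul]
  refine lt_of_le_of_lt (degree_smul_le _ _) ?_
  rw [hp k]
  exact WithBot.coe_lt_coe.2 k.2

theorem degree_monicOPUC (w : Circle → ℝ) (n : ℕ) :
    (monicOPUC w n).degree = (n : WithBot ℕ) := by
  induction n using Nat.strong_induction_on with
  | _ n ih =>
    rw [monicOPUC, sub_eq_add_neg, degree_add_eq_left_of_degree_lt, degree_X_pow]
    rw [degree_neg, degree_X_pow]
    exact degree_sum_lt n _ _ fun k => ih k k.2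

theorem natDegree_monicOPUC (w : Circle → ℝ) (n : ℕ) : (monicOPUC w n).natDegree = n :=
  natDegree_eq_of_degree_eq_some (degree_monicOPUC w n)

theorem monicOPUC_monic (w : Circle → ℝ) (n : ℕ) : (monicOPUC w n).Monic := by
  rw [monicOPUC]
  refine monic_X_pow_sub ?_
  exact degree_sum_lt n _ _ fun k => degree_monicOPUC w k

theorem IsAnalyticWeight.continuous {w : Circle → ℝ} (hw : IsAnalyticWeight w) :
    Continuous (fun θ : ℝ => w (Circle.exp θ)) :=
  continuousOn_univ.1 hw.analytic.continuousOn

theorem IsAnalyticWeight.continuous_integrand {w : Circle → ℝ} (hw : IsAnalyticWeight w)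
    (P Q : ℂ[X]) : Continuous (fun θ : ℝ =>
      P.eval (Circle.exp θ : ℂ) * conj (Q.eval (Circle.exp θ : ℂ)) *
        (w (Circle.exp θ) : ℂ)) := by
  have h := hw.continuous
  have hP : Continuous (fun θ : ℝ => P.eval (Circle.exp θ : ℂ)) :=
    P.continuous.comp (by fun_prop)
  have hQ : Continuous (fun θ : ℝ => Q.eval (Circle.exp θ : ℂ)) :=
    Q.continuous.comp (by fun_prop)
  exact (hP.mul (Complex.continuous_conj.comp hQ)).mul (Complex.continuous_ofReal.comp h)

theorem opucInner_sub_left {w : Circle → ℝ} (hw : IsAnalyticWeight w) (P Q R : ℂ[X]) :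
    opucInner w (P - Q) R = opucInner w P R - opucInner w Q R := by
  unfold opucInner
  rw [← intervalIntegral.integral_sub
    ((hw.continuous_integrand P R).intervalIntegrable _ _)
    ((hw.continuous_integrand Q R).intervalIntegrable _ _)]
  congr 1
  ext θ
  simp only [eval_sub]
  ring

theorem opucInner_C_mul_left (w : Circle → ℝ) (c : ℂ) (P R : ℂ[X]) :
    opucInner w (C c * P) R = c * opucInner w P R := by
  unfold opucInner
  rw [← intervalIntegral.integral_const_mul]
  congr 1
  ext θ
  simp only [eval_mul, eval_C]
  ring

theorem opucInner_sum_left {w : Circle → ℝ} (hw : IsAnalyticWeight w) {ι : Type*}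
    (s : Finset ι) (P : ι → ℂ[X]) (R : ℂ[X]) :
    opucInner w (∑ i ∈ s, P i) R = ∑ i ∈ s, opucInner w (P i) R := by
  unfold opucInner
  rw [← intervalIntegral.integral_finsetSum
    (fun i _ => (hw.continuous_integrand (P i) R).intervalIntegrable _ _)]
  congr 1
  ext θ
  simp only [eval_finsetSum, Finset.sum_mul]

theorem opucInner_conj (w : Circle → ℝ) (P Q : ℂ[X]) :
    conj (opucInner w P Q) = opucInner w Q P := by
  unfold opucInner
  rw [← intervalIntegral.intervalIntegral_conj]
  congr 1
  ext θ
  simp only [map_mul, Complex.conj_conj, Complex.conj_ofReal]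
  ring

theorem opucInner_self_ne_zero {w : Circle → ℝ} (hw : IsAnalyticWeight w) {P : ℂ[X]}
    (hP : P ≠ 0) : opucInner w P P ≠ 0 := by
  have hcont : Continuous (fun θ : ℝ =>
      ‖P.eval (Circle.exp θ : ℂ)‖ ^ 2 * w (Circle.exp θ)) := by
    have hP : Continuous (fun θ : ℝ => P.eval (Circle.exp θ : ℂ)) :=
      P.continuous.comp (by fun_prop)
    exact (hP.norm.pow 2).mul hw.continuous
  have heq : opucInner w P P =
      ((∫ θ in (0 : ℝ)..2 * Real.pi,
        ‖P.eval (Circle.exp θ : ℂ)‖ ^ 2 * w (Circle.exp θ) : ℝ) : ℂ) := by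
    unfold opucInner
    rw [← intervalIntegral.integral_ofReal]
    congr 1
    ext θ
    rw [Complex.mul_conj, Complex.normSq_eq_norm_sq]
    push_cast
    rfl
  rw [heq, Complex.ofReal_ne_zero]
  have hex : ∃ θ ∈ Set.Icc (0 : ℝ) (2 * Real.pi), P.eval (Circle.exp θ : ℂ) ≠ 0 := by
    by_contra hcon
    push Not at hcon
    apply hP
    refine Polynomial.eq_zero_of_infinite_isRoot P ?_
    have hinj : Set.InjOn (fun θ : ℝ => (Circle.exp θ : ℂ)) (Set.Ico 0 (2 * Real.pi)) :=
      fun x hx y hy hxy =>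
        Circle.exp_injOn_Ico (by simp) hx hy (Circle.ext hxy)
    refine ((Set.infinite_image_iff hinj).2
      (Set.Ico_infinite Real.two_pi_pos)).mono ?_
    rintro _ ⟨θ, hθ, rfl⟩
    exact hcon θ (Set.Ico_subset_Icc_self hθ)
  obtain ⟨θ, hθ, hne⟩ := hex
  refine (intervalIntegral.integral_pos Real.two_pi_pos hcont.continuousOn
    (fun x _ => mul_nonneg (by positivity) (hw.pos _).le) ⟨θ, hθ, ?_⟩).ne'
  exact mul_pos (pow_pos (norm_pos_iff.2 hne) 2) (hw.pos _)

theorem opucInner_monicOPUC_of_lt {w : Circle → ℝ} (hw : IsAnalyticWeight w) (n : ℕ) :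
    ∀ k < n, opucInner w (monicOPUC w n) (monicOPUC w k) = 0 := by
  induction n using Nat.strong_induction_on with
  | _ n ih =>
    intro k hk
    have hz : ∀ j : Fin n, (j : ℕ) ≠ k →
        opucInner w (monicOPUC w j) (monicOPUC w k) = 0 := by
      intro j hj
      rcases lt_or_gt_of_ne hj with h | h
      · rw [← opucInner_conj, ih k hk j h, map_zero]
      · exact ih j j.2 k h
    rw [monicOPUC, opucInner_sub_left hw, opucInner_sum_left hw,
      Finset.sum_eq_single (⟨k, hk⟩ : Fin n)]
    · rw [opucInner_C_mul_left, div_mul_cancel₀, sub_self]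
      exact opucInner_self_ne_zero hw (monicOPUC_monic w k).ne_zero
    · intro j _ hj
      rw [opucInner_C_mul_left, hz j (fun h => hj (Fin.ext h)), mul_zero]
    · simp

/-- `Φ_n` is orthogonal to every polynomial of degree less than `n`. -/
theorem opucInner_monicOPUC {w : Circle → ℝ} (hw : IsAnalyticWeight w) (n : ℕ) (Q : ℂ[X])
    (hQ : Q.degree < (n : WithBot ℕ)) : opucInner w (monicOPUC w n) Q = 0 := by
  suffices h : ∀ m ≤ n, ∀ Q : ℂ[X], Q.degree < (m : WithBot ℕ) →
      opucInner w Q (monicOPUC w n) = 0 by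
    rw [← opucInner_conj, h n le_rfl Q hQ, map_zero]
  intro m
  induction m with
  | zero =>
    intro _ Q hQ
    have : Q = 0 := by
      rw [← degree_eq_bot]
      simpa using hQ
    simp [this, opucInner]
  | succ m ih =>
    intro hm Q hQ
    have hdecomp : Q = (Q - C (Q.coeff m) * monicOPUC w m) -
        C (-Q.coeff m) * monicOPUC w m := by
      simp
    have hlow : (Q - C (Q.coeff m) * monicOPUC w m).degree < (m : WithBot ℕ) := by
      rw [degree_lt_iff_coeff_zero]
      intro j hj
      rcases hj.eq_or_lt with rfl | hj
      · have := (monicOPUC_monic w m).coeff_natDegree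
        rw [natDegree_monicOPUC] at this
        simp [this]
      · have h1 : Q.coeff j = 0 := (degree_lt_iff_coeff_zero _ _).1 hQ j hj
        have h2 : (monicOPUC w m).coeff j = 0 :=
          coeff_eq_zero_of_natDegree_lt (by rw [natDegree_monicOPUC]; exact hj)
        simp [h1, h2]
    rw [hdecomp, opucInner_sub_left hw, opucInner_C_mul_left, ih (by omega) _ hlow,
      ← opucInner_conj w (monicOPUC w n), opucInner_monicOPUC_of_lt hw n m (by omega)]
    simp

/-- `Φ_n` is the only monic polynomial of degree `n` with this orthogonality. -/
theorem eq_monicOPUC {w : Circle → ℝ} (hw : IsAnalyticWeight w) (n : ℕ) (P : ℂ[X])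
    (hP : P.Monic) (hdeg : P.natDegree = n)
    (horth : ∀ Q : ℂ[X], Q.degree < (n : WithBot ℕ) → opucInner w P Q = 0) :
    P = monicOPUC w n := by
  by_contra hne
  have hlt : (P - monicOPUC w n).degree < (n : WithBot ℕ) := by
    have hd : P.degree = (n : WithBot ℕ) := by
      rw [degree_eq_natDegree hP.ne_zero, hdeg]
    rw [← hd]
    refine degree_sub_lt_left (by rw [hd, degree_monicOPUC]) hP.ne_zero ?_
    rw [hP.leadingCoeff, (monicOPUC_monic w n).leadingCoeff]
  refine opucInner_self_ne_zero hw (sub_ne_zero.2 hne) ?_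
  rw [opucInner_sub_left hw, horth _ hlt, opucInner_monicOPUC hw n _ hlt, sub_zero]

/-- `D_e(w; z) → D_e(w; ∞)` as `z → ∞`. -/
theorem tendsto_szegoFunction_cobounded {w : Circle → ℝ} (hw : IsAnalyticWeight w) :
    Tendsto (szegoFunction w) (Bornology.cobounded ℂ) (𝓝 (szegoAtInfty w)) := by
  have hlog : Continuous (fun θ : ℝ => (Real.log (w (Circle.exp θ)) : ℂ)) :=
    Complex.continuous_ofReal.comp (hw.continuous.log fun θ => (hw.pos _).ne')
  have hkey : Tendsto (fun z : ℂ => ∫ θ in (0 : ℝ)..2 * Real.pi,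
      (Real.log (w (Circle.exp θ)) : ℂ) *
        (((Circle.exp θ : ℂ) + z) / ((Circle.exp θ : ℂ) - z)))
      (Bornology.cobounded ℂ)
      (𝓝 (∫ θ in (0 : ℝ)..2 * Real.pi, (Real.log (w (Circle.exp θ)) : ℂ) * (-1))) := by
    have : (Bornology.cobounded ℂ).IsCountablyGenerated := by
      rw [← comap_norm_atTop]
      infer_instance
    refine intervalIntegral.tendsto_integral_filter_of_dominated_convergence
      (fun θ => ‖(Real.log (w (Circle.exp θ)) : ℂ)‖ * 3) ?_ ?_ ?_ ?_
    · refine Eventually.of_forall fun z => Measurable.aestronglyMeasurable ?_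
      have h1 := hlog.measurable
      have h2 : Measurable (fun θ : ℝ => (Circle.exp θ : ℂ)) := by
        have : Continuous (fun θ : ℝ => (Circle.exp θ : ℂ)) := by fun_prop
        exact this.measurable
      exact h1.mul ((h2.add_const z).div (h2.sub_const z))
    · have h2 : ∀ᶠ z : ℂ in Bornology.cobounded ℂ, 2 ≤ ‖z‖ :=
        tendsto_norm_cobounded_atTop.eventually_ge_atTop 2
      filter_upwards [h2] with z hz
      refine Eventually.of_forall fun θ _ => ?_
      rw [norm_mul, norm_div]
      refine mul_le_mul_of_nonneg_left ?_ (norm_nonneg _)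
      have hc : ‖(Circle.exp θ : ℂ)‖ = 1 := Circle.norm_coe _
      have ha : ‖(Circle.exp θ : ℂ) + z‖ ≤ 1 + ‖z‖ := by
        have := norm_add_le (Circle.exp θ : ℂ) z
        rwa [hc] at this
      have hb : ‖z‖ - 1 ≤ ‖(Circle.exp θ : ℂ) - z‖ := by
        have := norm_sub_norm_le z (Circle.exp θ : ℂ)
        rwa [hc, norm_sub_rev] at this
      rw [div_le_iff₀ (by linarith)]
      linarith
    · exact (hlog.norm.mul continuous_const).intervalIntegrable _ _
    · refine Eventually.of_forall fun θ _ => ?_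
      refine Tendsto.mul tendsto_const_nhds ?_
      have hinv : Tendsto (fun z : ℂ => z⁻¹) (Bornology.cobounded ℂ) (𝓝 0) :=
        tendsto_inv₀_cobounded
      have hlim : Tendsto (fun z : ℂ => ((Circle.exp θ : ℂ) * z⁻¹ + 1) /
          ((Circle.exp θ : ℂ) * z⁻¹ - 1)) (Bornology.cobounded ℂ)
          (𝓝 (((Circle.exp θ : ℂ) * 0 + 1) / ((Circle.exp θ : ℂ) * 0 - 1))) :=
        ((hinv.const_mul _).add_const 1).div ((hinv.const_mul _).sub_const 1) (by simp)
      have hval : ((Circle.exp θ : ℂ) * 0 + 1) / ((Circle.exp θ : ℂ) * 0 - 1) = -1 := by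
        norm_num
      rw [hval] at hlim
      refine hlim.congr' ?_
      have h2 : ∀ᶠ z : ℂ in Bornology.cobounded ℂ, 2 ≤ ‖z‖ :=
        tendsto_norm_cobounded_atTop.eventually_ge_atTop 2
      filter_upwards [h2] with z hz
      have hz0 : z ≠ 0 := by
        rintro rfl
        norm_num at hz
      rw [← mul_div_mul_right _ _ hz0]
      congr 1
      · rw [add_mul, mul_assoc, inv_mul_cancel₀ hz0, mul_one, one_mul]
      · rw [sub_mul, mul_assoc, inv_mul_cancel₀ hz0, mul_one, one_mul]
  have := (Complex.continuous_exp.tendsto _).comp (hkey.const_mul (1 / (4 * (Real.pi : ℂ))))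
  simp only [mul_neg, mul_one, intervalIntegral.integral_neg] at this
  exact this

end Szego

end

namespace Szego

open Complex Metric Set Real MeasureTheory Bornology

/-! ### Contour integrals over circles -/

/-! Put `D = De` and let `E` be the continuation of `1 / D_i` across the circle, so that on the
circle `w = 1 / (D E)` and `D / E = 𝒮`. Orthogonality kills the first `n` moments of `Φ_n / (D E)`.
Splitting this function into parts holomorphic inside and outside the circle therefore gives, on the
circle, `Φ_n / E = z^n 𝒮 G + H`, with `G` holomorphic inside, `H` holomorphic outside and vanishing
at infinity (`exists_splitting`).

Cauchy integrals turn this relation into a linear system. `H` is the transform of `t^n 𝒮 G` over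
`|t| = r`, and `1 / D_e(∞) - G` is the transform of `t^(-n) H / 𝒮` over `|t| = 1/r`. Each passage
gains `r^n`, so `G = 1 / D_e(∞) + O(r^(2n))` on `|z| = r` (`exists_correction`,
`exists_correction_bound`). The formula for `Φ_n / E` inside the disc, with `G` replaced by this
constant, gives (`exists_main_bound`) `Φ_n(z) = (D_i(0) / D_i(z)) (1 / 2πi) ∮_{|t| = r} 𝒮(t) t^n /
(t - z) dt + O(r^(3n))`.

Shrinking the contour to a radius `ρ₁ < ρ` crosses the points `a_k`, whose residues form `R_n`, and
crosses `t = z` when `|z| > ρ₁`, which produces `z^n D_e(z) / D_e(∞)`. What is left is `O(ρ₁^n)`,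
that is `O(ρ^n δ^n)` with `δ = ρ₁ / ρ`. Nothing is assumed on the type of the singularities `a_k`,
so the residue theorem is proved for arbitrary isolated singularities
(`circleIntegral_annulus_eq_sum_residue`). -/

theorem circleIntegral_eq_of_annulus {f : ℂ → ℂ} {c : ℂ} {r R : ℝ} (hr : 0 < r) (hrR : r ≤ R)
    (hf : ∀ z, r ≤ ‖z - c‖ → ‖z - c‖ ≤ R → DifferentiableAt ℂ f z) :
    (∮ z in C(c, R), f z) = ∮ z in C(c, r), f z := by
  refine circleIntegral_eq_of_differentiable_on_annulus_off_countable hr hrR countable_empty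
    (fun z hz => ?_) (fun z hz => ?_)
  · simp only [Set.mem_sdiff, mem_closedBall, mem_ball, dist_eq_norm, not_lt] at hz
    exact (hf z hz.2 hz.1).continuousAt.continuousWithinAt
  · simp only [Set.mem_sdiff, mem_closedBall, mem_ball, dist_eq_norm, not_le] at hz
    exact hf z hz.1.2.le hz.1.1.le

theorem continuousOn_sphere_of_differentiableAt {f : ℂ → ℂ} {c : ℂ} {r : ℝ}
    (hf : ∀ z, ‖z - c‖ = r → DifferentiableAt ℂ f z) : ContinuousOn f (sphere c r) :=
  fun z hz => (hf z (by simpa [dist_eq_norm] using hz)).continuousAt.continuousWithinAt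

theorem circleIntegrable_of_differentiableAt {f : ℂ → ℂ} {c : ℂ} {r : ℝ} (hr : 0 ≤ r)
    (hf : ∀ z, ‖z - c‖ = r → DifferentiableAt ℂ f z) : CircleIntegrable f c r :=
  (continuousOn_sphere_of_differentiableAt hf).circleIntegrable hr

/-- Integral over a circle of a function holomorphic outside, in terms of its behaviour at
infinity. -/
theorem circleIntegral_of_exterior {f : ℂ → ℂ} {c l : ℂ} {r : ℝ} (hr : 0 < r)
    (hf : ∀ z, r ≤ ‖z - c‖ → DifferentiableAt ℂ f z)
    (hl : Tendsto (fun z => (z - c) * f z) (cobounded ℂ) (𝓝 l)) :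
    (∮ z in C(c, r), f z) = 2 * π * I * l := by
  refine eq_of_sub_eq_zero (norm_le_zero_iff.1 (le_of_forall_pos_le_add fun ε hε => ?_))
  have hε' : 0 < ε / (2 * π) := by positivity
  obtain ⟨R₀, -, hR₀⟩ := hasBasis_cobounded_norm.mem_iff.1 (Metric.tendsto_nhds.1 hl _ hε')
  -- On the circle of radius `R` about `c` one has `‖z‖ ≥ R - ‖c‖ ≥ R₀`, so there `f` is close to `l
  -- / (z - c)`.
  set R := max r (|R₀| + ‖c‖) with hR
  have hrR : r ≤ R := le_max_left _ _
  have hRpos : 0 < R := hr.trans_le hrR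
  rw [← circleIntegral_eq_of_annulus hr hrR fun z hz _ => hf z hz]
  have h1 : (∮ z in C(c, R), l / (z - c)) = 2 * π * I * l := by
    simp only [div_eq_mul_inv, circleIntegral.integral_const_mul]
    rw [circleIntegral.integral_sub_center_inv c hRpos.ne', mul_comm]
  have hne : ∀ z, ‖z - c‖ = R → z - c ≠ 0 := fun z hz => norm_ne_zero_iff.1 (by
    rw [hz]; exact hRpos.ne')
  rw [← h1, ← circleIntegral.integral_sub]
  · have := circleIntegral.norm_integral_le_of_norm_le_const (f := fun z => f z - l / (z - c))
      (c := c) (C := ε / (2 * π) / R) hRpos.le ?_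
    · refine this.trans (le_of_eq ?_)
      field_simp
      ring
    · intro z hz
      have hz' : ‖z - c‖ = R := by simpa [dist_eq_norm] using hz
      have h0 := hne z hz'
      have hb : R₀ ≤ ‖z‖ := by
        have h2 := norm_sub_le z c
        have h3 : |R₀| + ‖c‖ ≤ R := le_max_right _ _
        linarith [le_abs_self R₀]
      have h4 := hR₀ (show z ∈ {x | R₀ ≤ ‖x‖} from hb)
      simp only [mem_ofPred_eq, dist_eq_norm] at h4
      have h5 : f z - l / (z - c) = ((z - c) * f z - l) / (z - c) := by field_simp
      rw [h5, norm_div, hz']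
      gcongr
  · exact circleIntegrable_of_differentiableAt hRpos.le fun z hz => hf z (hz ▸ hrR)
  · exact circleIntegrable_of_differentiableAt hRpos.le fun z hz =>
      (differentiableAt_const l).div (by fun_prop) (hne z hz)

theorem tendsto_div_sub_cobounded (z : ℂ) :
    Tendsto (fun t : ℂ => t / (t - z)) (cobounded ℂ) (𝓝 1) := by
  have h : Tendsto (fun t : ℂ => (1 - z * t⁻¹)⁻¹) (cobounded ℂ) (𝓝 1) := by
    have := ((tendsto_inv₀_cobounded (α := ℂ)).const_mul z).const_sub 1
    simpa using this.inv₀ (by simp)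
  refine h.congr' ?_
  filter_upwards [eventually_cobounded_le_norm (E := ℂ) (‖z‖ + 1)] with t ht
  have ht0 : t ≠ 0 := norm_pos_iff.1 (by linarith [norm_nonneg z])
  have htz : t - z ≠ 0 := by
    rw [sub_ne_zero]
    rintro rfl
    linarith
  have : (1 - z * t⁻¹) = (t - z) / t := by field_simp
  rw [this, inv_div]

theorem circleIntegral_div_sub_of_exterior {f : ℂ → ℂ} {l z : ℂ} {r : ℝ} (hz : ‖z‖ < r)
    (hf : ∀ t, r ≤ ‖t‖ → DifferentiableAt ℂ f t) (hl : Tendsto f (cobounded ℂ) (𝓝 l)) :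
    (∮ t in C(0, r), f t / (t - z)) = 2 * π * I * l := by
  refine circleIntegral_of_exterior ((norm_nonneg z).trans_lt hz) (fun t ht => ?_) ?_
  · rw [sub_zero] at ht
    refine (hf t ht).div (by fun_prop) ?_
    rw [sub_ne_zero]
    rintro rfl
    linarith
  · have := (tendsto_div_sub_cobounded z).mul hl
    simp only [one_mul] at this
    refine this.congr fun t => ?_
    simp only [sub_zero]
    ring

theorem circleIntegral_div_sub_eq_zero {f : ℂ → ℂ} {z : ℂ} {r : ℝ} (hr : 0 ≤ r) (hz : r < ‖z‖)
    (hf : ∀ t, ‖t‖ ≤ r → DifferentiableAt ℂ f t) :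
    (∮ t in C(0, r), f t / (t - z)) = 0 := by
  have hd : ∀ t : ℂ, ‖t‖ ≤ r → DifferentiableAt ℂ (fun t => f t / (t - z)) t := fun t ht => by
    refine (hf t ht).div (by fun_prop) ?_
    rw [sub_ne_zero]
    rintro rfl
    linarith
  refine circleIntegral_eq_zero_of_differentiable_on_off_countable hr countable_empty
    (fun t ht => (hd t (by simpa using ht)).continuousAt.continuousWithinAt) fun t ht => ?_
  exact hd t (by simpa using (mem_ball_zero_iff.1 ht.1).le)

theorem circleIntegral_div_sub_of_disc {f : ℂ → ℂ} {z : ℂ} {r : ℝ} (hz : ‖z‖ < r)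
    (hf : ∀ t, ‖t‖ ≤ r → DifferentiableAt ℂ f t) :
    (∮ t in C(0, r), f t / (t - z)) = 2 * π * I * f z :=
  circleIntegral_div_sub_of_differentiable_on_off_countable countable_empty
    (by simpa using hz) (fun t ht => (hf t (by simpa using ht)).continuousAt.continuousWithinAt)
    fun t ht => hf t (by simpa using (mem_ball_zero_iff.1 ht.1).le)

theorem circleIntegrable_div_sub {f : ℂ → ℂ} {z : ℂ} {r : ℝ} (hr : 0 ≤ r) (hz : ‖z‖ ≠ r)
    (hf : ContinuousOn f (sphere 0 r)) : CircleIntegrable (fun t => f t / (t - z)) 0 r := by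
  refine ContinuousOn.circleIntegrable hr (hf.div (by fun_prop) fun t ht => ?_)
  rw [sub_ne_zero]
  rintro rfl
  exact hz (by simpa using ht)

theorem differentiableAt_dslope {f : ℂ → ℂ} {z t : ℂ} (hz : ∀ᶠ u in 𝓝 z, DifferentiableAt ℂ f u)
    (ht : DifferentiableAt ℂ f t) : DifferentiableAt ℂ (dslope f z) t := by
  rcases eq_or_ne t z with rfl | h
  · have h1 : DifferentiableOn ℂ f {u | DifferentiableAt ℂ f u} := fun u hu =>
      hu.differentiableWithinAt
    exact ((Complex.differentiableOn_dslope hz).2 h1).differentiableAt hz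
  · exact (differentiableAt_dslope_of_ne h).2 ht

/-- The Cauchy integral formula on an annulus. -/
theorem cauchy_annulus {f : ℂ → ℂ} {z : ℂ} {r R : ℝ} (hr : 0 < r) (hz : r < ‖z‖) (hzR : ‖z‖ < R)
    (hf : ∀ t, r ≤ ‖t‖ → ‖t‖ ≤ R → DifferentiableAt ℂ f t) :
    (∮ t in C(0, R), f t / (t - z)) - (∮ t in C(0, r), f t / (t - z)) = 2 * π * I * f z := by
  have hev : ∀ᶠ u in 𝓝 z, DifferentiableAt ℂ f u := by
    filter_upwards [continuous_norm.continuousAt.eventually (lt_mem_nhds hz),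
      continuous_norm.continuousAt.eventually (gt_mem_nhds hzR)] with u h1 h2
    exact hf u h1.le h2.le
  -- The difference quotient has a removable singularity at `z`, so it is holomorphic on the whole
  -- annulus.
  have h1 : (∮ t in C(0, R), dslope f z t) = ∮ t in C(0, r), dslope f z t :=
    circleIntegral_eq_of_annulus hr (hz.trans hzR).le fun t ht htR =>
      differentiableAt_dslope hev (hf t (by simpa using ht) (by simpa using htR))
  have key : ∀ s : ℝ, 0 < s → ‖z‖ ≠ s → r ≤ s → s ≤ R → (∮ t in C(0, s), dslope f z t) =
      (∮ t in C(0, s), f t / (t - z)) - ∮ t in C(0, s), f z / (t - z) := by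
    intro s hs hzs hrs hsR
    rw [← circleIntegral.integral_sub
      (circleIntegrable_div_sub hs.le hzs (continuousOn_sphere_of_differentiableAt fun t ht =>
        hf t (by simp at ht; linarith) (by simp at ht; linarith)))
      (circleIntegrable_div_sub (f := fun _ => f z) hs.le hzs continuousOn_const)]
    refine circleIntegral.integral_congr hs.le fun t ht => ?_
    have : t ≠ z := by
      rintro rfl
      exact hzs (by simpa using ht)
    simp only [dslope_of_ne _ this, slope_def_field, sub_div]
  rw [key R (by linarith [norm_nonneg z]) hzR.ne (by linarith) le_rfl,
    key r hr hz.ne' le_rfl (by linarith),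
    circleIntegral_div_sub_of_disc (f := fun _ => f z) hzR (fun _ _ => by fun_prop),
    circleIntegral_div_sub_eq_zero (f := fun _ => f z) hr.le hz (fun _ _ => by fun_prop)] at h1
  linear_combination h1

/-- Cauchy's formula for the exterior domain: in the annulus formula the outer circle contributes
nothing because `f` vanishes at infinity. -/
theorem circleIntegral_div_sub_of_exterior_of_lt {f : ℂ → ℂ} {z : ℂ} {r : ℝ} (hr : 0 < r)
    (hz : r < ‖z‖) (hf : ∀ t, r ≤ ‖t‖ → DifferentiableAt ℂ f t)
    (hl : Tendsto f (cobounded ℂ) (𝓝 0)) :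
    (∮ t in C(0, r), f t / (t - z)) = -(2 * π * I * f z) := by
  have h1 := cauchy_annulus hr hz (lt_add_one ‖z‖) fun t ht _ => hf t ht
  rw [circleIntegral_div_sub_of_exterior (lt_add_one ‖z‖) (fun t ht => hf t (by linarith)) hl] at h1
  linear_combination -h1

/-- Cauchy integrals are holomorphic off the circle. -/
theorem differentiableAt_cauchyIntegral {f : ℂ → ℂ} {c z : ℂ} {R : ℝ} (hR : 0 ≤ R)
    (hf : ContinuousOn f (sphere c R)) (hz : z ∉ sphere c R) :
    DifferentiableAt ℂ (fun z => ∮ t in C(c, R), f t / (t - z)) z := by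
  -- A lower bound for the kernel's denominator that is uniform near `z`, needed to dominate the
  -- derivative of the integrand.
  obtain ⟨d, hd, hball⟩ : ∃ d > 0, ∀ x ∈ ball z d, ∀ t ∈ sphere c R, d ≤ ‖t - x‖ := by
    obtain ⟨e, he, hsub⟩ := Metric.isOpen_iff.1 isClosed_sphere.isOpen_compl z hz
    refine ⟨e / 2, by positivity, fun x hx t ht => ?_⟩
    by_contra hcon
    push Not at hcon
    rw [mem_ball] at hx
    rw [← dist_eq_norm] at hcon
    exact hsub (show t ∈ ball z e by rw [mem_ball]; linarith [dist_triangle t x z]) ht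
  have hcont : Continuous fun θ => f (circleMap c R θ) :=
    hf.comp_continuous (continuous_circleMap c R) fun θ => circleMap_mem_sphere c hR θ
  have hne : ∀ x ∈ ball z d, ∀ θ, circleMap c R θ - x ≠ 0 := fun x hx θ => norm_pos_iff.1
    (hd.trans_le (hball x hx _ (circleMap_mem_sphere c hR θ)))
  have hder : Continuous fun θ => deriv (circleMap c R) θ := by
    simp only [deriv_circleMap]
    exact (continuous_circleMap 0 R).mul continuous_const
  have hF : ∀ x ∈ ball z d, Continuous fun θ => deriv (circleMap c R) θ •
      (f (circleMap c R θ) / (circleMap c R θ - x)) := fun x hx =>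
    hder.smul (hcont.div ((continuous_circleMap c R).sub continuous_const) (hne x hx))
  have hF' : ∀ x ∈ ball z d, Continuous fun θ => deriv (circleMap c R) θ •
      (f (circleMap c R θ) / (circleMap c R θ - x) ^ 2) := fun x hx =>
    hder.smul (hcont.div (((continuous_circleMap c R).sub continuous_const).pow 2)
      fun θ => pow_ne_zero 2 (hne x hx θ))
  have hzd : z ∈ ball z d := mem_ball_self hd
  have hb : Continuous fun θ => R * (‖f (circleMap c R θ)‖ / d ^ 2) :=
    continuous_const.mul (hcont.norm.div_const _)
  refine (intervalIntegral.hasDerivAt_integral_of_dominated_loc_of_deriv_le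
    (F' := fun x θ => deriv (circleMap c R) θ •
      (f (circleMap c R θ) / (circleMap c R θ - x) ^ 2))
    (bound := fun θ => R * (‖f (circleMap c R θ)‖ / d ^ 2))
    (ball_mem_nhds z hd) ?_ ((hF z hzd).intervalIntegrable _ _)
    (hF' z hzd).aestronglyMeasurable ?_ (hb.intervalIntegrable _ _) ?_).2.differentiableAt
  · filter_upwards [ball_mem_nhds z hd] with x hx using (hF x hx).aestronglyMeasurable
  · refine Eventually.of_forall fun θ _ x hx => ?_
    have h1 : ‖deriv (circleMap c R) θ‖ = R := by
      simp [deriv_circleMap, abs_of_nonneg hR]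
    rw [norm_smul, norm_div, norm_pow, h1]
    gcongr
    exact hball x hx _ (circleMap_mem_sphere c hR θ)
  · refine Eventually.of_forall fun θ _ x hx => ?_
    simp only [smul_eq_mul]
    refine HasDerivAt.const_mul _ ?_
    have h2 := (((hasDerivAt_id' x).const_sub (circleMap c R θ)).fun_inv (hne x hx θ)).const_mul
      (f (circleMap c R θ))
    simpa [div_eq_mul_inv] using h2

/-- Identifies the `1 / z` coefficient at infinity. For the principal part at an isolated
singularity this coefficient is the residue. -/
theorem tendsto_mul_cauchyIntegral {f : ℂ → ℂ} {c : ℂ} {R : ℝ} (hR : 0 ≤ R)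
    (hf : ContinuousOn f (sphere c R)) :
    Tendsto (fun z => z * ∮ t in C(c, R), f t / (t - z)) (cobounded ℂ)
      (𝓝 (-∮ t in C(c, R), f t)) := by
  obtain ⟨M, hM⟩ := (isCompact_sphere c R).exists_bound_of_continuousOn hf
  rw [tendsto_iff_norm_sub_tendsto_zero]
  have hlim : Tendsto (fun z : ℂ => 2 * π * R * (M * ((‖c‖ + R) / (‖z‖ - (‖c‖ + R)))))
      (cobounded ℂ) (𝓝 0) := by
    have h1 : Tendsto (fun z : ℂ => ‖z‖ - (‖c‖ + R)) (cobounded ℂ) atTop :=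
      tendsto_atTop_add_const_right _ _ tendsto_norm_cobounded_atTop
    have h2 := ((h1.const_div_atTop (‖c‖ + R)).const_mul M).const_mul (2 * π * R)
    simpa using h2
  refine squeeze_zero' (Eventually.of_forall fun _ => norm_nonneg _) ?_ hlim
  filter_upwards [eventually_cobounded_le_norm (E := ℂ) (‖c‖ + R + 1)] with z hz
  have hne : ∀ t ∈ sphere c R, ‖t‖ ≤ ‖c‖ + R := fun t ht => by
    have := norm_add_le (t - c) c
    rw [sub_add_cancel] at this
    rw [mem_sphere, dist_eq_norm] at ht
    linarith
  have hne' : ∀ t ∈ sphere c R, ‖z‖ - (‖c‖ + R) ≤ ‖t - z‖ := fun t ht => by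
    have h1 := norm_sub_norm_le z t
    rw [norm_sub_rev] at h1
    linarith [hne t ht]
  have h0 : ∀ t ∈ sphere c R, t - z ≠ 0 := fun t ht => norm_pos_iff.1 (by
    linarith [hne' t ht])
  have hint : CircleIntegrable (fun t => z * (f t / (t - z))) c R :=
    (continuousOn_const.mul (hf.div (by fun_prop) h0)).circleIntegrable hR
  rw [sub_neg_eq_add, ← circleIntegral.integral_const_mul,
    ← circleIntegral.integral_add hint (hf.circleIntegrable hR)]
  refine circleIntegral.norm_integral_le_of_norm_le_const hR fun t ht => ?_
  have h1 : z * (f t / (t - z)) + f t = f t * (t / (t - z)) := by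
    field_simp [h0 t ht]
    ring
  rw [h1, norm_mul, norm_div]
  have hMn : 0 ≤ M := (norm_nonneg _).trans (hM t ht)
  have hcR : 0 ≤ ‖c‖ + R := by positivity
  gcongr
  · exact hM t ht
  · linarith
  · exact hne t ht
  · exact hne' t ht

/-! ### Residues -/

theorem circleIntegral_translate (f : ℂ → ℂ) (a : ℂ) (R : ℝ) :
    (∮ t in C(a, R), f t) = ∮ t in C(0, R), f (t + a) := by
  simp only [circleIntegral, deriv_circleMap, circleMap, zero_add]
  simp only [add_comm]

theorem eventually_closedBall_subset {U : Set ℂ} {a : ℂ} (hU : U ∈ 𝓝 a) :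
    ∀ᶠ ε : ℝ in 𝓝[>] 0, 0 < ε ∧ closedBall a ε ⊆ U := by
  obtain ⟨e, he, hsub⟩ := Metric.nhds_basis_closedBall.mem_iff.1 hU
  filter_upwards [Ioc_mem_nhdsGT he] with ε hε
  exact ⟨hε.1, (closedBall_subset_closedBall hε.2).trans hsub⟩

theorem residue_eq_of_eventually {f : ℂ → ℂ} {a J : ℂ}
    (h : ∀ᶠ ε : ℝ in 𝓝[>] 0, (∮ t in C(a, ε), f t) = 2 * π * I * J) : residue f a = J := by
  refine Tendsto.limUnder_eq (tendsto_const_nhds.congr' ?_)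
  filter_upwards [h] with ε hε
  rw [hε, inv_mul_cancel_left₀ two_pi_I_ne_zero]

theorem residue_congr_of_eventually {f g : ℂ → ℂ} {a : ℂ}
    (h : ∀ᶠ ε : ℝ in 𝓝[>] 0, (∮ t in C(a, ε), f t) = ∮ t in C(a, ε), g t) :
    residue f a = residue g a := by
  unfold residue limUnder
  rw [Filter.map_congr]
  filter_upwards [h] with ε hε
  rw [hε]

theorem circleIntegral_eq_zero_of_closedBall {f : ℂ → ℂ} {a : ℂ} {ε : ℝ} (hε : 0 ≤ ε)
    (hf : ∀ z ∈ closedBall a ε, DifferentiableAt ℂ f z) : (∮ t in C(a, ε), f t) = 0 :=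
  circleIntegral_eq_zero_of_differentiable_on_off_countable hε countable_empty
    (fun t ht => (hf t ht).continuousAt.continuousWithinAt)
    fun t ht => hf t (ball_subset_closedBall ht.1)

/-- Splitting off the principal part at an isolated singularity. -/
theorem exists_principalPart {f : ℂ → ℂ} {a : ℂ} {U : Set ℂ} (hU : U ∈ 𝓝 a)
    (hf : ∀ z ∈ U, z ≠ a → DifferentiableAt ℂ f z) :
    ∃ (p g : ℂ → ℂ) (J : ℂ), (∀ z, z ≠ a → DifferentiableAt ℂ p z) ∧
      Tendsto (fun z => z * p z) (cobounded ℂ) (𝓝 J) ∧ DifferentiableAt ℂ g a ∧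
      ∀ z, f z = p z + g z := by
  obtain ⟨R, hR, hsub⟩ := Metric.nhds_basis_closedBall.mem_iff.1 hU
  have hfd : ∀ z, 0 < ‖z - a‖ → ‖z - a‖ ≤ R → DifferentiableAt ℂ f z := fun z h1 h2 =>
    hf z (hsub (by simpa [dist_eq_norm] using h2)) (sub_ne_zero.1 (norm_pos_iff.1 h1))
  have hc : ∀ s, 0 < s → s ≤ R → ContinuousOn f (sphere a s) := fun s hs hsR =>
    continuousOn_sphere_of_differentiableAt fun z hz => hfd z (hz ▸ hs) (hz ▸ hsR)
  have hR2 : 0 < R / 2 := half_pos hR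
  set q : ℂ → ℂ := fun z => (2 * π * I)⁻¹ * ∮ t in C(a, R / 2), f t / (t - z) with hq
  set k : ℂ → ℂ := fun z => (2 * π * I)⁻¹ * ∮ t in C(a, R), f t / (t - z) with hk
  have hkd : ∀ z, ‖z - a‖ < R → DifferentiableAt ℂ k z := fun z hz =>
    (differentiableAt_cauchyIntegral hR.le (hc R hR le_rfl) (by
      simpa [dist_eq_norm] using hz.ne)).const_mul _
  have hqd : ∀ z, R / 2 < ‖z - a‖ → DifferentiableAt ℂ q z := fun z hz =>
    (differentiableAt_cauchyIntegral hR2.le (hc _ hR2 (by linarith)) (by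
      simpa [dist_eq_norm] using hz.ne')).const_mul _
  have hkq : ∀ z, R / 2 < ‖z - a‖ → ‖z - a‖ < R → k z - q z = f z := by
    intro z h1 h2
    have := cauchy_annulus (f := fun t => f (t + a)) hR2 h1 h2 fun t ht htR =>
      (hfd (t + a) (by rw [add_sub_cancel_right]; linarith)
        (by rwa [add_sub_cancel_right])).comp t (by fun_prop)
    simp only [hk, hq]
    rw [circleIntegral_translate, circleIntegral_translate _ a (R / 2), ← mul_sub]
    simp only [sub_sub_eq_add_sub, sub_add_cancel] at this
    rw [this, inv_mul_cancel_left₀ two_pi_I_ne_zero]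
  classical
  -- Near `a`, `g` is the Cauchy integral over the large circle. The second branch makes `f - g`
  -- equal to `-q` all the way to infinity, whatever `f` does away from `a`; the branches agree on
  -- the annulus by `hkq`.
  set g : ℂ → ℂ := fun z => if ‖z - a‖ < R then k z else f z + q z with hg
  have hopen1 : IsOpen {z : ℂ | ‖z - a‖ < R} := isOpen_lt (by fun_prop) (by fun_prop)
  have hopen2 : IsOpen {z : ℂ | R / 2 < ‖z - a‖} := isOpen_lt (by fun_prop) (by fun_prop)
  have hgk : ∀ z, ‖z - a‖ < R → g =ᶠ[𝓝 z] k := fun z hz => by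
    filter_upwards [hopen1.mem_nhds hz] with y hy
    exact if_pos hy
  have hp : ∀ z, R / 2 < ‖z - a‖ → f z - g z = -q z := fun z hz => by
    by_cases h : ‖z - a‖ < R
    · rw [hg]
      simp only [if_pos h]
      linear_combination -hkq z hz h
    · rw [hg]
      simp only [if_neg h]
      ring
  refine ⟨fun z => f z - g z, g, (2 * π * I)⁻¹ * ∮ t in C(a, R / 2), f t, fun z hz => ?_, ?_, ?_,
    fun z => by ring⟩
  · have h0 : 0 < ‖z - a‖ := norm_pos_iff.2 (sub_ne_zero.2 hz)
    rcases lt_or_ge ‖z - a‖ R with h | h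
    · exact (hfd z h0 h.le).sub ((hkd z h).congr_of_eventuallyEq (hgk z h))
    · refine (hqd z (by linarith)).neg.congr_of_eventuallyEq ?_
      filter_upwards [hopen2.mem_nhds (show R / 2 < ‖z - a‖ by linarith)] with y hy
      exact hp y hy
  · have h1 := (tendsto_mul_cauchyIntegral hR2.le (hc _ hR2 (by linarith))).const_mul
      (-(2 * π * I : ℂ)⁻¹)
    rw [neg_mul_neg] at h1
    refine h1.congr' ?_
    filter_upwards [eventually_cobounded_le_norm (E := ℂ) (‖a‖ + R)] with z hz
    rw [hp z (by linarith [norm_sub_norm_le z a])]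
    simp only [hq]
    ring
  · have ha : ‖a - a‖ < R := by simpa using hR
    exact (hkd a ha).congr_of_eventuallyEq (hgk a ha)

theorem tendsto_sub_mul_of_tendsto_mul {p : ℂ → ℂ} {a J : ℂ}
    (h : Tendsto (fun z => z * p z) (cobounded ℂ) (𝓝 J)) :
    Tendsto (fun z => (z - a) * p z) (cobounded ℂ) (𝓝 J) := by
  have h1 := ((tendsto_inv₀_cobounded (α := ℂ)).const_mul a).const_sub 1 |>.mul h
  simp only [mul_zero, sub_zero, one_mul] at h1
  refine h1.congr' ?_
  filter_upwards [eventually_cobounded_le_norm (E := ℂ) 1] with z hz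
  have : z ≠ 0 := norm_pos_iff.1 (by linarith)
  field_simp

/-- Induction on the singular points. The principal part `p` at `a` is holomorphic off `a`, so it
contributes `2πi J` to the outer circle, nothing to the inner one, and does not alter the residues
at the other points. The remainder `g` is regular at `a`. Essential singularities are covered. -/
theorem circleIntegral_annulus_eq_sum_residue {r R : ℝ} (hr : 0 < r) (hrR : r ≤ R)
    (B : Finset ℂ) : ∀ f : ℂ → ℂ, (∀ b ∈ B, r < ‖b‖ ∧ ‖b‖ < R) →
    (∀ z, r ≤ ‖z‖ → ‖z‖ ≤ R → z ∉ B → DifferentiableAt ℂ f z) →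
    (∮ t in C(0, R), f t) = (∮ t in C(0, r), f t) + 2 * π * I * ∑ b ∈ B, residue f b := by
  classical
  induction B using Finset.induction_on with
  | empty =>
    intro f _ hf
    rw [circleIntegral_eq_of_annulus hr hrR fun z h1 h2 => hf z (by simpa using h1)
      (by simpa using h2) (by simp)]
    simp
  | insert a B ha ih =>
    intro f hB hf
    have hRp : 0 < R := hr.trans_le hrR
    have hopen : ∀ S : Finset ℂ, IsOpen ({z : ℂ | r < ‖z‖ ∧ ‖z‖ < R} \ (S : Set ℂ)) := fun S =>
      ((isOpen_lt continuous_const continuous_norm).inter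
        (isOpen_lt continuous_norm continuous_const)).sdiff S.finite_toSet.isClosed
    have haB := hB a (Finset.mem_insert_self a B)
    have hUa : {z : ℂ | r < ‖z‖ ∧ ‖z‖ < R} \ (B : Set ℂ) ∈ 𝓝 a :=
      (hopen B).mem_nhds ⟨haB, by simpa using ha⟩
    obtain ⟨p, g, J, hp, hJ, hga, hfg⟩ := exists_principalPart hUa (f := f) fun z hz hza =>
      hf z hz.1.1.le hz.1.2.le (by
        rw [Finset.mem_insert, not_or]
        exact ⟨hza, by simpa using hz.2⟩)
    have hgd : ∀ z, r ≤ ‖z‖ → ‖z‖ ≤ R → z ∉ B → DifferentiableAt ℂ g z := by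
      intro z h1 h2 hzB
      rcases eq_or_ne z a with rfl | hza
      · exact hga
      · have h3 := (hf z h1 h2 (by simp [hza, hzB])).sub (hp z hza)
        refine h3.congr_of_eventuallyEq (Eventually.of_forall fun y => ?_)
        simp [hfg y]
    have hadd : ∀ (c : ℂ) (s : ℝ), 0 ≤ s → (∀ z, ‖z - c‖ = s → DifferentiableAt ℂ p z) →
        (∀ z, ‖z - c‖ = s → DifferentiableAt ℂ g z) →
        (∮ t in C(c, s), f t) = (∮ t in C(c, s), p t) + ∮ t in C(c, s), g t := by
      intro c s hs h1 h2
      rw [← circleIntegral.integral_add (circleIntegrable_of_differentiableAt hs h1)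
        (circleIntegrable_of_differentiableAt hs h2)]
      exact circleIntegral.integral_congr hs fun t _ => hfg t
    have hpa : ∀ ε : ℝ, 0 < ε → (∮ t in C(a, ε), p t) = 2 * π * I * J := fun ε hε =>
      circleIntegral_of_exterior hε (fun z hz => hp z fun h => by
        rw [h, sub_self, norm_zero] at hz; linarith) (tendsto_sub_mul_of_tendsto_mul hJ)
    have hres_a : residue f a = J := by
      refine residue_eq_of_eventually ?_
      filter_upwards [eventually_closedBall_subset hUa] with ε hε
      have hgε : ∀ z ∈ closedBall a ε, DifferentiableAt ℂ g z := fun z hz =>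
        hgd z (hε.2 hz).1.1.le (hε.2 hz).1.2.le (by simpa using (hε.2 hz).2)
      rw [hadd a ε hε.1.le, hpa ε hε.1, circleIntegral_eq_zero_of_closedBall hε.1.le hgε, add_zero]
      · intro z hz
        refine hp z fun h => ?_
        rw [h, sub_self, norm_zero] at hz
        linarith [hε.1]
      · exact fun z hz => hgε z (by simp [dist_eq_norm, hz])
    have hres : ∀ b ∈ B, residue f b = residue g b := by
      intro b hb
      have hba : b ≠ a := fun h => ha (h ▸ hb)
      have hbB := hB b (Finset.mem_insert_of_mem hb)
      refine residue_congr_of_eventually ?_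
      filter_upwards [eventually_closedBall_subset ((hopen ((insert a B).erase b)).mem_nhds
        ⟨hbB, by simp⟩)] with ε hε
      have hza : ∀ z ∈ closedBall b ε, z ≠ a := fun z hz h => (hε.2 hz).2 (by
        simp [h, hba.symm])
      have hpε : ∀ z ∈ closedBall b ε, DifferentiableAt ℂ p z := fun z hz => hp z (hza z hz)
      rw [hadd b ε hε.1.le, circleIntegral_eq_zero_of_closedBall hε.1.le hpε, zero_add]
      · exact fun z hz => hpε z (by simp [dist_eq_norm, hz])
      · intro z hz
        have hzc : z ∈ closedBall b ε := by simp [dist_eq_norm, hz]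
        have hzb : z ≠ b := fun h => by
          rw [h, sub_self, norm_zero] at hz
          linarith [hε.1]
        refine hgd z (hε.2 hzc).1.1.le (hε.2 hzc).1.2.le fun h => (hε.2 hzc).2 ?_
        simp [hzb, h]
    have hne : ∀ s : ℝ, ‖a‖ ≠ s → ∀ z : ℂ, ‖z - 0‖ = s → z ≠ a := fun s hs z hz h => hs (by
      rw [← h, ← hz, sub_zero])
    have hBn : ∀ s : ℝ, (∀ b ∈ B, ‖b‖ ≠ s) → ∀ z : ℂ, ‖z‖ = s → z ∉ B := fun s hs z hz h =>
      hs z h hz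
    have hb' := fun b hb => hB b (Finset.mem_insert_of_mem hb)
    rw [hadd 0 R hRp.le (fun z hz => hp z (hne R haB.2.ne z hz)) (fun z hz => by
        rw [sub_zero] at hz
        exact hgd z (hz ▸ hrR) hz.le (hBn R (fun b hb => (hb' b hb).2.ne) z hz)),
      hadd 0 r hr.le (fun z hz => hp z (hne r haB.1.ne' z hz)) (fun z hz => by
        rw [sub_zero] at hz
        exact hgd z hz.ge (hz ▸ hrR) (hBn r (fun b hb => (hb' b hb).1.ne') z hz)),
      ih g hb' hgd, Finset.sum_insert ha, hres_a, Finset.sum_congr rfl hres]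
    have h1 : (∮ t in C(0, R), p t) = 2 * π * I * J :=
      circleIntegral_of_exterior hRp (fun z hz => hp z fun h => by
        rw [h, sub_zero] at hz
        linarith [haB.2]) (tendsto_sub_mul_of_tendsto_mul hJ)
    have h2 : (∮ t in C(0, r), p t) = 0 :=
      circleIntegral_eq_zero_of_closedBall hr.le fun z hz => hp z fun h => by
        rw [h, mem_closedBall_zero_iff] at hz
        linarith [haB.1]
    rw [h1, h2]
    ring

/-- Allows `t = z` to be treated as one more singular point when a contour crosses it. -/
theorem residue_div_sub {f : ℂ → ℂ} {z : ℂ} (hf : ∀ᶠ u in 𝓝 z, DifferentiableAt ℂ f u) :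
    residue (fun t => f t / (t - z)) z = f z := by
  refine residue_eq_of_eventually ?_
  filter_upwards [eventually_closedBall_subset hf] with ε hε
  exact circleIntegral_div_sub_of_differentiable_on_off_countable countable_empty
    (mem_ball_self hε.1) (fun t ht => (hε.2 ht).continuousAt.continuousWithinAt)
    fun t ht => hε.2 (ball_subset_closedBall ht.1)

/-! ### The Szegő function -/

theorem szegoFunction_ne_zero (w : Circle → ℝ) (z : ℂ) : szegoFunction w z ≠ 0 :=
  Complex.exp_ne_zero _

theorem szegoAtInfty_ne_zero (w : Circle → ℝ) : szegoAtInfty w ≠ 0 := Complex.exp_ne_zero _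

theorem szegoFunction_zero (w : Circle → ℝ) : szegoFunction w 0 = (szegoAtInfty w)⁻¹ := by
  rw [szegoFunction, szegoAtInfty, ← Complex.exp_neg, neg_neg]
  simp

/-- On the circle `conj ζ = ζ⁻¹`, so the Herglotz kernel at the reflected point is minus the
conjugate of the kernel at `z`. This links `D_e` to `D_i`. -/
theorem szegoFunction_inv_conj (w : Circle → ℝ) {z : ℂ} (hz : z ≠ 0) :
    szegoFunction w (conj z)⁻¹ = (conj (szegoFunction w z))⁻¹ := by
  have hz' : conj z ≠ 0 := (_root_.map_ne_zero _).2 hz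
  rw [szegoFunction, szegoFunction, ← Complex.exp_conj, ← Complex.exp_neg]
  congr 1
  rw [map_mul, ← intervalIntegral.intervalIntegral_conj, ← mul_neg,
    ← intervalIntegral.integral_neg]
  congr 1
  · simp [map_ofNat]
  · congr 1
    ext θ
    have hζ : conj (Circle.exp θ : ℂ) = (Circle.exp θ : ℂ)⁻¹ := by
      rw [← Circle.coe_inv_eq_conj, Circle.coe_inv]
    have h0 : (Circle.exp θ : ℂ) ≠ 0 := Circle.coe_ne_zero _
    simp only [map_mul, map_div₀, map_add, map_sub, Complex.conj_ofReal, hζ]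
    rw [← mul_neg]
    congr 1
    have h1 : (Circle.exp θ : ℂ) + (conj z)⁻¹ =
        ((Circle.exp θ : ℂ)⁻¹ + conj z) * ((Circle.exp θ : ℂ) / conj z) := by
      field_simp
      ring
    have h2 : (Circle.exp θ : ℂ) - (conj z)⁻¹ =
        -(((Circle.exp θ : ℂ)⁻¹ - conj z) * ((Circle.exp θ : ℂ) / conj z)) := by
      field_simp
      ring
    have h3 : (Circle.exp θ : ℂ) / conj z ≠ 0 := div_ne_zero h0 hz'
    rw [h1, h2, div_neg, mul_div_mul_right _ _ h3]

theorem IsAnalyticWeight.continuous_log {w : Circle → ℝ} (hw : IsAnalyticWeight w) :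
    Continuous fun θ : ℝ => Real.log (w (Circle.exp θ)) :=
  hw.continuous.log fun _ => (hw.pos _).ne'

theorem circleMap_zero_one (θ : ℝ) : circleMap 0 1 θ = (Circle.exp θ : ℂ) := by
  simp [circleMap, Circle.coe_exp]

theorem differentiableAt_szegoFunction {w : Circle → ℝ} (hw : IsAnalyticWeight w) {z : ℂ}
    (hz : ‖z‖ < 1) : DifferentiableAt ℂ (szegoFunction w) z := by
  -- The weight is extended to the plane through `arg` so that the integral becomes a circle
  -- average. The jump of `arg` is harmless, since `w ∘ Circle.exp` is periodic. The factor `1 / 2`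
  -- used below is `1 / (4π)` divided by `1 / (2π)`.
  set L : ℂ → ℂ := fun ζ => (Real.log (w (Circle.exp ζ.arg)) : ℂ) with hL
  have hLθ : ∀ θ : ℝ, L (Circle.exp θ : ℂ) = (Real.log (w (Circle.exp θ)) : ℂ) := fun θ => by
    simp only [hL, Circle.exp_arg]
  have hint : CircleIntegrable L 0 1 := by
    refine Continuous.intervalIntegrable ?_ _ _
    simp only [circleMap_zero_one, hLθ]
    exact Complex.continuous_ofReal.comp hw.continuous_log
  have h1 := (differentiableOn_circleAverage_herglotzRieszKernel_smul hint).differentiableAt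
    (isOpen_ball.mem_nhds (mem_ball_zero_iff.2 hz))
  refine (h1.const_mul (1 / 2)).cexp.congr_of_eventuallyEq (Eventually.of_forall fun u => ?_)
  simp only [szegoFunction, circleAverage_def, circleMap_zero_one, hLθ, herglotzRieszKernel_def,
    sub_zero, smul_eq_mul]
  congr 1
  rw [Complex.real_smul, ← mul_assoc]
  congr 1
  · push_cast
    field_simp
    norm_num
  · simp only [mul_comm]

/-- The squared modulus of the Szegő function is the exponential of a Poisson integral. -/
theorem norm_sq_szegoFunction {w : Circle → ℝ} (hw : IsAnalyticWeight w) {z : ℂ} (hz : ‖z‖ < 1) :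
    ‖szegoFunction w z‖ ^ 2 = Real.exp (∫ θ in Icc 0 (2 * π),
      ((2 * π)⁻¹ * ((1 - ‖z‖ ^ 2) / ‖(Circle.exp θ : ℂ) - z‖ ^ 2)) •
        Real.log (w (Circle.exp θ))) := by
  have hcont : Continuous fun θ : ℝ => (Real.log (w (Circle.exp θ)) : ℂ) *
      (((Circle.exp θ : ℂ) + z) / ((Circle.exp θ : ℂ) - z)) := by
    refine (Complex.continuous_ofReal.comp hw.continuous_log).mul (Continuous.div (by fun_prop)
      (by fun_prop) fun θ h => ?_)
    rw [← sub_eq_zero.1 h, Circle.norm_coe] at hz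
    exact lt_irrefl _ hz
  have hre : ∀ θ : ℝ, (((Circle.exp θ : ℂ) + z) / ((Circle.exp θ : ℂ) - z)).re =
      (1 - ‖z‖ ^ 2) / ‖(Circle.exp θ : ℂ) - z‖ ^ 2 := fun θ => by
    have := congrFun (poissonKernel_eq_re_herglotzRieszKernel (c := 0) (w := z)) (Circle.exp θ : ℂ)
    simp only [poissonKernel_def, Function.comp_apply, herglotzRieszKernel_def, sub_zero,
      Circle.norm_coe, one_pow] at this
    exact this.symm
  rw [szegoFunction, Complex.norm_exp, ← Real.exp_nat_mul, integral_Icc_eq_integral_Ioc,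
    ← intervalIntegral.integral_of_le Real.two_pi_pos.le]
  congr 1
  have h1 : (1 / (4 * (π : ℂ))) = ((1 / (4 * π) : ℝ) : ℂ) := by push_cast; rfl
  have h2 := reCLM.intervalIntegral_comp_comm (hcont.intervalIntegrable (μ := volume) 0 (2 * π))
  simp only [reCLM_apply] at h2
  rw [h1, Complex.re_ofReal_mul, ← h2, ← intervalIntegral.integral_const_mul,
    ← intervalIntegral.integral_const_mul]
  congr 1
  ext θ
  rw [Complex.re_ofReal_mul, hre, smul_eq_mul]
  field_simp
  push_cast
  ring

/-- The Poisson kernel is an approximate identity, so the Poisson integral of `log w` has radial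
limit `log w`. The angle is kept off the endpoints `0` and `2π`, which are the same point of the
circle and would give the kernel two peaks on the interval. -/
theorem tendsto_norm_sq_szegoFunction {w : Circle → ℝ} (hw : IsAnalyticWeight w) {θ₀ : ℝ}
    (hθ : θ₀ ∈ Ioo 0 (2 * π)) :
    Tendsto (fun x : ℝ => ‖szegoFunction w (x * (Circle.exp θ₀ : ℂ))‖ ^ 2) (𝓝[<] 1)
      (𝓝 (w (Circle.exp θ₀))) := by
  set ζ : ℂ := (Circle.exp θ₀ : ℂ) with hζ
  have hζ1 : ‖ζ‖ = 1 := Circle.norm_coe _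
  set φ : ℝ → ℝ → ℝ := fun x θ =>
    (2 * π)⁻¹ * ((1 - ‖(x : ℂ) * ζ‖ ^ 2) / ‖(Circle.exp θ : ℂ) - x * ζ‖ ^ 2) with hφ
  have hnorm : ∀ x : ℝ, 0 < x → ‖(x : ℂ) * ζ‖ = x := fun x hx => by
    rw [norm_mul, hζ1, mul_one, Complex.norm_real, Real.norm_of_nonneg hx.le]
  have hIoo : ∀ᶠ x : ℝ in 𝓝[<] 1, x ∈ Ioo (0 : ℝ) 1 := Ioo_mem_nhdsLT one_pos
  have hne : ∀ x ∈ Ioo (0 : ℝ) 1, ∀ θ : ℝ, (Circle.exp θ : ℂ) - x * ζ ≠ 0 := fun x hx θ h => by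
    have := hnorm x hx.1
    rw [← sub_eq_zero.1 h, Circle.norm_coe] at this
    linarith [hx.2]
  have hφc : ∀ x ∈ Ioo (0 : ℝ) 1, Continuous (φ x) := fun x hx => by
    refine continuous_const.mul (Continuous.div continuous_const (by fun_prop) fun θ => ?_)
    exact pow_ne_zero 2 (norm_ne_zero_iff.2 (hne x hx θ))
  have key := tendsto_setIntegral_peak_smul_of_integrableOn_of_tendsto (μ := volume)
    (l := 𝓝[<] (1 : ℝ)) (φ := φ) (x₀ := θ₀) (s := Icc 0 (2 * π)) (t := Icc 0 (2 * π))
    (g := fun θ => Real.log (w (Circle.exp θ))) (a := Real.log (w (Circle.exp θ₀)))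
    measurableSet_Icc measurableSet_Icc subset_rfl self_mem_nhdsWithin
    measure_Icc_lt_top.ne ?_ ?_ ?_ ?_ hw.continuous_log.integrableOn_Icc
    (hw.continuous_log.continuousAt.mono_left nhdsWithin_le_nhds)
  · have h2 := (Real.continuous_exp.tendsto _).comp key
    rw [Real.exp_log (hw.pos _)] at h2
    refine h2.congr' ?_
    filter_upwards [hIoo] with x hx
    exact (norm_sq_szegoFunction hw (by rw [hnorm x hx.1]; exact hx.2)).symm
  · filter_upwards [hIoo] with x hx θ _
    have : (0 : ℝ) ≤ 1 - ‖(x : ℂ) * ζ‖ ^ 2 := by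
      rw [hnorm x hx.1]
      nlinarith [hx.1, hx.2]
    positivity
  · intro u hu hθu
    obtain ⟨m, hm, hmle⟩ : ∃ m > 0, ∀ θ ∈ Icc 0 (2 * π) \ u, m ≤ ‖(Circle.exp θ : ℂ) - ζ‖ := by
      have hc : IsCompact (Icc 0 (2 * π) \ u) := isCompact_Icc.diff hu
      refine hc.exists_forall_le' (f := fun θ : ℝ => ‖(Circle.exp θ : ℂ) - ζ‖)
        (by fun_prop) (a := 0) fun θ hθ' => ?_
      rw [norm_pos_iff, sub_ne_zero]
      intro h
      have h' : Circle.exp θ = Circle.exp θ₀ := Circle.ext h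
      refine hθ'.2 ?_
      have : θ = θ₀ := by
        obtain ⟨k, hk⟩ := Circle.exp_eq_exp.1 h'
        have h1 := hθ'.1.1
        have h2 := hθ'.1.2
        have h3 := hθ.1
        have h4 := hθ.2
        have hpi := Real.two_pi_pos
        have hk1 : (k : ℝ) < 1 := by
          by_contra hcon
          push Not at hcon
          nlinarith
        have hk2 : (-1 : ℝ) < k := by
          by_contra hcon
          push Not at hcon
          nlinarith
        have hk0 : k = 0 := by
          have a1 : k < 1 := by exact_mod_cast hk1
          have a2 : -1 < k := by exact_mod_cast hk2
          omega
        rw [hk, hk0]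
        simp
      rwa [this]
    rw [Metric.tendstoUniformlyOn_iff]
    intro ε hε
    -- Replacing `ζ` by `x ζ` costs `1 - x < m / 2`, so off `u` the denominator keeps the bound `m /
    -- 2`.
    have hlim : Tendsto (fun x : ℝ => (2 * π)⁻¹ * ((1 - x ^ 2) / (m / 2) ^ 2)) (𝓝[<] 1) (𝓝 0) := by
      have : Continuous fun x : ℝ => (2 * π)⁻¹ * ((1 - x ^ 2) / (m / 2) ^ 2) := by fun_prop
      have h := (this.tendsto 1).mono_left (nhdsWithin_le_nhds (s := Iio 1))
      simpa using h
    filter_upwards [hIoo, hlim.eventually (gt_mem_nhds hε),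
      Ioo_mem_nhdsLT (show 1 - m / 2 < 1 by linarith)] with x hx hxε hxm θ hθ'
    have h0 : (0 : ℝ) ≤ 1 - x ^ 2 := by nlinarith [hx.1, hx.2]
    have h1 : m / 2 ≤ ‖(Circle.exp θ : ℂ) - x * ζ‖ := by
      have h2 : ‖(x : ℂ) * ζ - ζ‖ = 1 - x := by
        have : (x : ℂ) * ζ - ζ = ((x - 1 : ℝ) : ℂ) * ζ := by push_cast; ring
        rw [this, norm_mul, hζ1, mul_one, Complex.norm_real, Real.norm_eq_abs, abs_of_neg]
        · ring
        · linarith [hx.2]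
      have h3 := hmle θ hθ'
      have h4 := norm_add_le ((Circle.exp θ : ℂ) - x * ζ) (x * ζ - ζ)
      rw [sub_add_sub_cancel, h2] at h4
      linarith [hxm.1]
    have h5 : φ x θ ≤ (2 * π)⁻¹ * ((1 - x ^ 2) / (m / 2) ^ 2) := by
      simp only [hφ, hnorm x hx.1]
      gcongr
    have h6 : 0 ≤ φ x θ := by
      simp only [hφ, hnorm x hx.1]
      positivity
    simp only [Pi.zero_apply, dist_zero_left, Real.norm_of_nonneg h6]
    linarith
  · refine tendsto_const_nhds.congr' ?_
    filter_upwards [hIoo] with x hx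
    have hmem : (x : ℂ) * ζ ∈ ball (0 : ℂ) 1 := by
      rw [mem_ball_zero_iff, hnorm x hx.1]
      exact hx.2
    have h1 := (diffContOnCl_const (𝕜 := ℂ) (s := ball (0 : ℂ) 1)
      (c := (1 : ℂ))).circleAverage_poissonKernel_smul' hmem
    simp only [circleAverage_def, circleMap_zero_one, sub_zero, Circle.norm_coe, one_pow,
      Complex.real_smul, mul_one, intervalIntegral.integral_ofReal] at h1
    rw [integral_Icc_eq_integral_Ioc, ← intervalIntegral.integral_of_le Real.two_pi_pos.le,
      intervalIntegral.integral_const_mul]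
    exact_mod_cast h1.symm
  · filter_upwards [hIoo] with x hx
    exact (hφc x hx).aestronglyMeasurable

/-- By reflection `|D_e(ζ / x)| |D_i(x ζ)| = 1` for `0 < x < 1`; let `x → 1`. Continuity in `θ`
supplies the endpoints left out by the radial limit, and periodicity all other angles. -/
theorem norm_sq_mul_weight {w : Circle → ℝ} (hw : IsAnalyticWeight w) {De : ℂ → ℂ}
    (hDe : ∀ z, 1 < ‖z‖ → De z = szegoFunction w z) (hc : ∀ z, ‖z‖ = 1 → ContinuousAt De z)
    (θ : ℝ) : ‖De (Circle.exp θ : ℂ)‖ ^ 2 * w (Circle.exp θ) = 1 := by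
  have hmain : ∀ θ ∈ Ioo 0 (2 * π), ‖De (Circle.exp θ : ℂ)‖ ^ 2 * w (Circle.exp θ) = 1 := by
    intro θ hθ
    set ζ : ℂ := (Circle.exp θ : ℂ) with hζ
    have hζ1 : ‖ζ‖ = 1 := Circle.norm_coe _
    have hζ0 : ζ ≠ 0 := Circle.coe_ne_zero _
    have h1 : Tendsto (fun x : ℝ => (x : ℂ)⁻¹ * ζ) (𝓝[<] 1) (𝓝 ζ) := by
      have : ContinuousAt (fun x : ℝ => (x : ℂ)⁻¹ * ζ) 1 := by
        refine ContinuousAt.mul (ContinuousAt.inv₀ (by fun_prop) (by simp)) continuousAt_const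
      have := this.tendsto.mono_left (nhdsWithin_le_nhds (s := Iio 1))
      simpa using this
    have h2 := (((hc ζ hζ1).tendsto.comp h1).norm.pow 2).mul (tendsto_norm_sq_szegoFunction hw hθ)
    refine tendsto_nhds_unique h2 (tendsto_const_nhds.congr' ?_)
    filter_upwards [Ioo_mem_nhdsLT (zero_lt_one (α := ℝ))] with x hx
    have hx0 : (x : ℂ) ≠ 0 := by exact_mod_cast hx.1.ne'
    have h3 : (conj ((x : ℂ) * ζ))⁻¹ = (x : ℂ)⁻¹ * ζ := by
      rw [map_mul, Complex.conj_ofReal, mul_inv, hζ, ← Circle.coe_inv_eq_conj, Circle.coe_inv,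
        inv_inv]
    have h4 : 1 < ‖(x : ℂ)⁻¹ * ζ‖ := by
      rw [norm_mul, hζ1, mul_one, norm_inv, Complex.norm_real, Real.norm_of_nonneg hx.1.le]
      exact (one_lt_inv₀ hx.1).2 hx.2
    have h5 := szegoFunction_inv_conj w (mul_ne_zero hx0 hζ0)
    rw [h3] at h5
    simp only [Function.comp_apply]
    rw [hDe _ h4, h5, norm_inv, Complex.norm_conj, ← mul_pow, inv_mul_cancel₀, one_pow]
    exact norm_ne_zero_iff.2 (szegoFunction_ne_zero _ _)
  have hcont : Continuous fun θ : ℝ => ‖De (Circle.exp θ : ℂ)‖ ^ 2 * w (Circle.exp θ) := by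
    refine Continuous.mul (Continuous.pow (Continuous.norm ?_) 2) hw.continuous
    exact continuous_iff_continuousAt.2 fun θ => (hc _ (Circle.norm_coe _)).comp
      (f := fun θ : ℝ => (Circle.exp θ : ℂ)) (by fun_prop)
  have hcl : ∀ θ ∈ Icc 0 (2 * π), ‖De (Circle.exp θ : ℂ)‖ ^ 2 * w (Circle.exp θ) = 1 := by
    have := closure_minimal (fun θ hθ => hmain θ hθ) (isClosed_singleton.preimage hcont (t := {1}))
    rw [closure_Ioo Real.two_pi_pos.ne] at this
    exact fun θ hθ => this hθ
  obtain ⟨y, hy, hyθ⟩ := Circle.periodic_exp.exists_mem_Ico₀ Real.two_pi_pos θ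
  rw [hyθ]
  exact hcl y (Ico_subset_Icc_self hy)

/-- The analytic continuation of `1 / D_i` across the unit circle, in terms of `D_e`. -/
noncomputable def interiorInv (w : Circle → ℝ) (De : ℂ → ℂ) (z : ℂ) : ℂ :=
  open Classical in if ‖z‖ < 1 then (szegoFunction w z)⁻¹ else conj (De (conj z)⁻¹)

theorem interiorInv_of_lt {w : Circle → ℝ} {De : ℂ → ℂ} {z : ℂ} (hz : ‖z‖ < 1) :
    interiorInv w De z = (szegoFunction w z)⁻¹ := if_pos hz

theorem interiorInv_eq_conj {w : Circle → ℝ} {De : ℂ → ℂ}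
    (hDe : ∀ z, 1 < ‖z‖ → De z = szegoFunction w z) {z : ℂ} (hz : z ≠ 0) :
    interiorInv w De z = conj (De (conj z)⁻¹) := by
  by_cases h : ‖z‖ < 1
  · rw [interiorInv_of_lt h, hDe, szegoFunction_inv_conj w hz, map_inv₀, Complex.conj_conj]
    rw [norm_inv, Complex.norm_conj]
    exact (one_lt_inv₀ (norm_pos_iff.2 hz)).2 h
  · exact if_neg h

theorem interiorInv_exp {w : Circle → ℝ} {De : ℂ → ℂ} (θ : ℝ) :
    interiorInv w De (Circle.exp θ : ℂ) = conj (De (Circle.exp θ : ℂ)) := by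
  rw [interiorInv, if_neg (by simp), ← Circle.coe_inv_eq_conj, Circle.coe_inv, inv_inv]

/-- Schwarz reflection: holomorphy of `De` beyond radius `ρ` becomes holomorphy up to radius `ρ⁻¹`.
The origin, whose reflection is infinity, is handled by the defining formula. -/
theorem differentiableAt_interiorInv {w : Circle → ℝ} (hw : IsAnalyticWeight w) {De : ℂ → ℂ}
    (hDe : ∀ z, 1 < ‖z‖ → De z = szegoFunction w z) {ρ : ℝ} (hρ0 : 0 < ρ)
    (hd : ∀ z, ρ < ‖z‖ → DifferentiableAt ℂ De z) {z : ℂ} (hz : ‖z‖ < ρ⁻¹) :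
    DifferentiableAt ℂ (interiorInv w De) z := by
  rcases eq_or_ne z 0 with rfl | hz0
  · refine ((differentiableAt_szegoFunction hw (z := 0) (by simp)).inv
      (szegoFunction_ne_zero w 0)).congr_of_eventuallyEq ?_
    filter_upwards [ball_mem_nhds (0 : ℂ) one_pos] with u hu
    exact interiorInv_of_lt (mem_ball_zero_iff.1 hu)
  · have h1 : DifferentiableAt ℂ De (conj z⁻¹) := hd _ (by
      rw [Complex.norm_conj, norm_inv]
      exact (lt_inv_comm₀ (norm_pos_iff.2 hz0) hρ0).1 hz)
    have h2 := h1.conj_conj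
    rw [Complex.conj_conj] at h2
    have h3 := h2.comp z (differentiableAt_inv hz0)
    refine h3.congr_of_eventuallyEq ?_
    filter_upwards [isOpen_ne.mem_nhds hz0] with u hu
    rw [interiorInv_eq_conj hDe hu]
    simp

/-! ### The factorization problem for orthogonal polynomials -/

theorem ne_of_norm_ne {s t : ℂ} (h : ‖s‖ ≠ ‖t‖) : s ≠ t := fun h' => h (by rw [h'])

/-- The zeros in a closed annulus form a compact set disjoint from the circle. This makes `P / (D
E)` holomorphic on both sides of the circle. -/
theorem exists_ne_zero_near_unit_circle {f : ℂ → ℂ} {a b : ℝ}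
    (hf : ∀ z, a ≤ ‖z‖ → ‖z‖ ≤ b → DifferentiableAt ℂ f z) (h0 : ∀ z, ‖z‖ = 1 → f z ≠ 0) :
    ∃ η > 0, ∀ z, a ≤ ‖z‖ → ‖z‖ ≤ b → |‖z‖ - 1| < η → f z ≠ 0 := by
  have hS : IsCompact {z : ℂ | a ≤ ‖z‖ ∧ ‖z‖ ≤ b} :=
    (isCompact_closedBall (0 : ℂ) b).of_isClosed_subset
      ((isClosed_le continuous_const continuous_norm).inter
        (isClosed_le continuous_norm continuous_const)) fun z hz => by simpa using hz.2
  have hK : IsCompact ({z : ℂ | a ≤ ‖z‖ ∧ ‖z‖ ≤ b} ∩ f ⁻¹' {0}) :=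
    hS.of_isClosed_subset (ContinuousOn.preimage_isClosed_of_isClosed
      (fun z hz => (hf z hz.1 hz.2).continuousAt.continuousWithinAt) hS.isClosed
      isClosed_singleton) inter_subset_left
  obtain ⟨η, hη, h⟩ := hK.exists_forall_le' (f := fun z : ℂ => |‖z‖ - 1|) (by fun_prop) (a := 0)
    fun z hz => abs_pos.2 (sub_ne_zero.2 fun h => h0 z h hz.2)
  exact ⟨η, hη, fun z h1 h2 h3 h4 => absurd (h z ⟨⟨h1, h2⟩, h4⟩) (not_le.2 h3)⟩

theorem norm_circleIntegral_div_sub_le {f : ℂ → ℂ} {z : ℂ} {R B δ : ℝ} (hR : 0 ≤ R) (hδ : 0 < δ)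
    (hf : ∀ t, ‖t‖ = R → ‖f t‖ ≤ B) (hz : ∀ t, ‖t‖ = R → δ ≤ ‖t - z‖) :
    ‖∮ t in C(0, R), f t / (t - z)‖ ≤ 2 * π * R * (B / δ) := by
  refine circleIntegral.norm_integral_le_of_norm_le_const hR fun t ht => ?_
  have ht' : ‖t‖ = R := by simpa using ht
  rw [norm_div]
  have hB := (norm_nonneg _).trans (hf t ht')
  gcongr
  exacts [hf t ht', hz t ht']

/-- From `1 / (t - z) = 1 / t + z / (t (t - z))`, each vanishing moment pulls out one factor `z`. -/
theorem circleIntegral_div_sub_eq_pow_mul {F : ℂ → ℂ} {z : ℂ} {R : ℝ} {n : ℕ} (hR : 0 < R)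
    (hz : ‖z‖ < R) (hF : ContinuousOn F (sphere 0 R))
    (h0 : ∀ k < n, (∮ t in C(0, R), F t / t ^ (k + 1)) = 0) :
    ∀ k ≤ n, (∮ t in C(0, R), F t / (t - z)) =
      z ^ k * ∮ t in C(0, R), F t / t ^ k / (t - z) := by
  have hne : ∀ t ∈ sphere (0 : ℂ) R, t ≠ 0 := fun t ht => ne_of_mem_sphere ht hR.ne'
  have hc : ∀ k, ContinuousOn (fun t => F t / t ^ k) (sphere 0 R) := fun k =>
    hF.div (by fun_prop) fun t ht => pow_ne_zero _ (hne t ht)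
  intro k
  induction k with
  | zero => simp
  | succ k ih =>
    intro hk
    rw [ih (by omega), pow_succ, mul_assoc]
    congr 1
    have hsplit : (∮ t in C(0, R), F t / t ^ k / (t - z)) =
        (∮ t in C(0, R), z * (F t / t ^ (k + 1) / (t - z))) +
          ∮ t in C(0, R), F t / t ^ (k + 1) := by
      rw [← circleIntegral.integral_add]
      rotate_left
      · exact (continuousOn_const.mul ((hc (k + 1)).div (by fun_prop) fun t ht =>
          sub_ne_zero.2 (ne_of_norm_ne (by
            rw [mem_sphere_zero_iff_norm.1 ht]; exact hz.ne')))).circleIntegrable hR.le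
      · exact (hc (k + 1)).circleIntegrable hR.le
      · refine circleIntegral.integral_congr hR.le fun t ht => ?_
        have h1 := hne t ht
        have h2 : t - z ≠ 0 := sub_ne_zero.2 (ne_of_norm_ne (by
          rw [mem_sphere_zero_iff_norm.1 ht]; exact hz.ne'))
        field_simp
        ring
    rw [hsplit, h0 k (by omega), add_zero, circleIntegral.integral_const_mul]

/-- Analytic data of a weight `1 / (D E)` on the unit circle, with `D` and `E` holomorphic and
nonvanishing outside and inside the unit disc, both of them holomorphic across the circle. -/
structure IsFactorization (D E : ℂ → ℂ) (d : ℂ) (ρ : ℝ) : Prop where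
  pos : 0 < ρ
  lt_one : ρ < 1
  diff_ext : ∀ z, ρ < ‖z‖ → DifferentiableAt ℂ D z
  diff_int : ∀ z, ‖z‖ < ρ⁻¹ → DifferentiableAt ℂ E z
  ext_ne_zero : ∀ z, 1 ≤ ‖z‖ → D z ≠ 0
  int_ne_zero : ∀ z, ‖z‖ ≤ 1 → E z ≠ 0
  tendsto : Tendsto D (cobounded ℂ) (𝓝 d)
  limit_ne_zero : d ≠ 0

theorem tendsto_eval_div_pow {P : ℂ[X]} (hP : P.Monic) :
    Tendsto (fun t => P.eval t / t ^ P.natDegree) (cobounded ℂ) (𝓝 1) := by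
  have h1 : Tendsto (fun t : ℂ => P.reverse.eval t⁻¹) (cobounded ℂ) (𝓝 (P.reverse.eval 0)) :=
    (P.reverse.continuous.tendsto 0).comp tendsto_inv₀_cobounded
  rw [← coeff_zero_eq_eval_zero, coeff_zero_reverse, hP.leadingCoeff] at h1
  refine h1.congr' ?_
  filter_upwards [eventually_cobounded_le_norm (E := ℂ) 1] with t ht
  have ht0 : t ≠ 0 := norm_pos_iff.1 (by linarith)
  have := invertibleOfNonzero ht0
  have := eval₂_reverse_mul_pow (RingHom.id ℂ) t P
  simp only [invOf_eq_inv] at this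
  rw [eval, eval, ← this, mul_div_cancel_right₀ _ (pow_ne_zero _ ht0)]

/-! ### The linear system for `G` and `H`, and its solution for large `n` -/

namespace IsFactorization

variable {D E : ℂ → ℂ} {d : ℂ} {ρ : ℝ}

theorem one_lt_inv (h : IsFactorization D E d ρ) : 1 < ρ⁻¹ := (one_lt_inv₀ h.pos).2 h.lt_one

/-- Splitting of `P / (D E)` into a function holomorphic inside, with a zero of order `n` at the
origin, and a function holomorphic outside. -/
theorem exists_splitting (h : IsFactorization D E d ρ) {P : ℂ[X]} {n : ℕ}
    (horth : ∀ k < n, (∮ t in C(0, 1), P.eval t / (D t * E t) / t ^ (k + 1)) = 0) :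
    ∃ G H : ℂ → ℂ, (∀ z, ‖z‖ ≤ 1 → DifferentiableAt ℂ G z) ∧
      (∀ z, 1 ≤ ‖z‖ → DifferentiableAt ℂ H z) ∧ Tendsto H (cobounded ℂ) (𝓝 0) ∧
      ∀ z, ‖z‖ = 1 → P.eval z / E z = z ^ n * (D z / E z) * G z + H z := by
  obtain ⟨r, hρr, hr1⟩ := exists_between h.lt_one
  have hr0 : 0 < r := h.pos.trans hρr
  have hrinv : 1 < r⁻¹ := (one_lt_inv₀ hr0).2 hr1
  have hrρ : r⁻¹ < ρ⁻¹ := (inv_lt_inv₀ hr0 h.pos).2 hρr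
  obtain ⟨η, hη, hDη⟩ := exists_ne_zero_near_unit_circle (f := D) (a := r) (b := 1)
    (fun z h1 _ => h.diff_ext z (by linarith)) fun z hz => h.ext_ne_zero z hz.ge
  obtain ⟨κ, hκ, hEκ⟩ := exists_ne_zero_near_unit_circle (f := E) (a := 1) (b := r⁻¹)
    (fun z _ h1 => h.diff_int z (by linarith)) fun z hz => h.int_ne_zero z hz.le
  -- `D` has no zeros for `|z| ≥ R₁` and `E` none for `|z| ≤ R₂`, with `R₁ < 1 < R₂`. Splitting on
  -- this wider annulus makes both pieces holomorphic across the unit circle.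
  set R₁ : ℝ := max r (1 - η / 2) with hR₁
  set R₂ : ℝ := min r⁻¹ (1 + κ / 2) with hR₂
  have hR₁r : r ≤ R₁ := le_max_left _ _
  have hR₁1 : R₁ < 1 := max_lt hr1 (by linarith)
  have hR₁η : 1 - η / 2 ≤ R₁ := le_max_right _ _
  have hR₂r : R₂ ≤ r⁻¹ := min_le_left _ _
  have hR₂1 : 1 < R₂ := lt_min hrinv (by linarith)
  have hR₂κ : R₂ ≤ 1 + κ / 2 := min_le_right _ _
  have hR₁0 : 0 < R₁ := hr0.trans_le hR₁r
  have hR₂0 : 0 < R₂ := by linarith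
  have hD0 : ∀ z, R₁ ≤ ‖z‖ → D z ≠ 0 := fun z hz => by
    rcases le_or_gt 1 ‖z‖ with h1 | h1
    · exact h.ext_ne_zero z h1
    · exact hDη z (by linarith) h1.le (by rw [abs_lt]; constructor <;> linarith)
  have hE0 : ∀ z, ‖z‖ ≤ R₂ → E z ≠ 0 := fun z hz => by
    rcases le_or_gt ‖z‖ 1 with h1 | h1
    · exact h.int_ne_zero z h1
    · exact hEκ z h1.le (by linarith) (by rw [abs_lt]; constructor <;> linarith)
  set F : ℂ → ℂ := fun t => P.eval t / (D t * E t) with hF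
  have hFd : ∀ z, R₁ ≤ ‖z‖ → ‖z‖ ≤ R₂ → DifferentiableAt ℂ F z := fun z h1 h2 =>
    P.differentiableAt.div ((h.diff_ext z (by linarith)).mul (h.diff_int z (by linarith)))
      (mul_ne_zero (hD0 z h1) (hE0 z h2))
  have hc₁ : ContinuousOn F (sphere 0 R₁) := continuousOn_sphere_of_differentiableAt fun z hz => by
    rw [sub_zero] at hz
    exact hFd z hz.ge (by linarith)
  have hc₂ : ContinuousOn F (sphere 0 R₂) := continuousOn_sphere_of_differentiableAt fun z hz => by
    rw [sub_zero] at hz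
    exact hFd z (by linarith) hz.le
  have hc₂n : ContinuousOn (fun t => F t / t ^ n) (sphere 0 R₂) :=
    hc₂.div (by fun_prop) fun t ht => pow_ne_zero _ (ne_of_mem_sphere ht hR₂0.ne')
  have h0 : ∀ k < n, (∮ t in C(0, R₂), F t / t ^ (k + 1)) = 0 := fun k hk => by
    rw [circleIntegral_eq_of_annulus one_pos hR₂1.le, horth k hk]
    intro z h1 h2
    rw [sub_zero] at h1 h2
    exact (hFd z (by linarith) h2).div (by fun_prop)
      (pow_ne_zero _ (norm_pos_iff.1 (by linarith)))
  set g : ℂ → ℂ := fun z => (2 * π * I)⁻¹ * ∮ t in C(0, R₂), F t / t ^ n / (t - z) with hg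
  set k : ℂ → ℂ := fun z => -(2 * π * I)⁻¹ * ∮ t in C(0, R₁), F t / (t - z) with hk
  have hkd : ∀ z, R₁ < ‖z‖ → DifferentiableAt ℂ k z := fun z hz =>
    (differentiableAt_cauchyIntegral hR₁0.le hc₁ (by
      rw [mem_sphere_zero_iff_norm]; exact hz.ne')).const_mul _
  have hgd : ∀ z, ‖z‖ < R₂ → DifferentiableAt ℂ g z := fun z hz =>
    (differentiableAt_cauchyIntegral hR₂0.le hc₂n (by
      rw [mem_sphere_zero_iff_norm]; exact hz.ne)).const_mul _
  have hkinf : Tendsto k (cobounded ℂ) (𝓝 0) := by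
    have h1 := ((tendsto_mul_cauchyIntegral hR₁0.le hc₁).const_mul
      (-(2 * π * I : ℂ)⁻¹)).mul (tendsto_inv₀_cobounded (α := ℂ))
    rw [mul_zero] at h1
    refine h1.congr' ?_
    filter_upwards [eventually_cobounded_le_norm (E := ℂ) 1] with t ht
    have ht0 : t ≠ 0 := norm_pos_iff.1 (by linarith)
    simp only [hk]
    field_simp
  -- Multiply `F = z^n g + k` by `D`, using `P / E = D F`.
  refine ⟨fun z => E z * g z, fun z => D z * k z, fun z hz => ?_, fun z hz => ?_, ?_,
    fun z hz => ?_⟩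
  · exact (h.diff_int z (by linarith [h.one_lt_inv])).mul (hgd z (by linarith))
  · exact (h.diff_ext z (by linarith [h.lt_one])).mul (hkd z (by linarith))
  · simpa using h.tendsto.mul hkinf
  · have h1 := cauchy_annulus hR₁0 (z := z) (R := R₂) (by linarith) (by linarith) hFd
    rw [circleIntegral_div_sub_eq_pow_mul hR₂0 (by linarith) hc₂ h0 n le_rfl] at h1
    have h2 : F z = z ^ n * g z + k z := by
      rw [← inv_mul_cancel_left₀ two_pi_I_ne_zero (F z), ← h1]
      simp only [hg, hk]
      ring
    have hDz := hD0 z (by linarith)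
    have hEz := hE0 z (by linarith)
    have h3 : P.eval z / E z = D z * F z := by
      simp only [hF]
      field_simp
    rw [h3, h2]
    field_simp

section Splitting

variable {P : ℂ[X]} {n : ℕ} {G H : ℂ → ℂ} {r : ℝ}

/-- At an exterior point `P / E`, holomorphic inside, has zero Cauchy integral, so `H` is recovered
from the other term. The contour then shrinks to `|t| = r`, where `t^n` has size `r^n`. -/
theorem circleIntegral_eq_of_exterior (h : IsFactorization D E d ρ) (hρr : ρ < r) (hr : r < 1)
    (hG : ∀ z, ‖z‖ ≤ 1 → DifferentiableAt ℂ G z)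
    (hH : ∀ z, 1 ≤ ‖z‖ → DifferentiableAt ℂ H z) (hH0 : Tendsto H (cobounded ℂ) (𝓝 0))
    (heq : ∀ z, ‖z‖ = 1 → P.eval z / E z = z ^ n * (D z / E z) * G z + H z)
    {z : ℂ} (hz : 1 < ‖z‖) :
    (∮ t in C(0, r), t ^ n * (D t / E t) * G t / (t - z)) = 2 * π * I * H z := by
  have hQ : ∀ t, r ≤ ‖t‖ → ‖t‖ ≤ 1 →
      DifferentiableAt ℂ (fun t => t ^ n * (D t / E t) * G t) t := fun t h1 h2 =>
    ((differentiableAt_pow n).mul ((h.diff_ext t (by linarith)).div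
      (h.diff_int t (by linarith [h.one_lt_inv])) (h.int_ne_zero t h2))).mul (hG t h2)
  have hPE : ∀ t, ‖t‖ ≤ 1 → DifferentiableAt ℂ (fun t => P.eval t / E t) t := fun t ht =>
    P.differentiableAt.div (h.diff_int t (by linarith [h.one_lt_inv])) (h.int_ne_zero t ht)
  have h1 := circleIntegral_div_sub_of_exterior_of_lt one_pos hz hH hH0
  have h2 := circleIntegral_div_sub_eq_zero zero_le_one hz hPE
  have h3 := circleIntegral_eq_of_annulus (f := fun t => t ^ n * (D t / E t) * G t / (t - z))
    (c := 0) (h.pos.trans hρr) hr.le fun t ht ht1 => by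
      rw [sub_zero] at ht ht1
      exact (hQ t ht ht1).div (by fun_prop) (sub_ne_zero.2 (ne_of_norm_ne (by linarith)))
  have h4 : (∮ t in C(0, 1), P.eval t / E t / (t - z)) =
      (∮ t in C(0, 1), t ^ n * (D t / E t) * G t / (t - z)) + ∮ t in C(0, 1), H t / (t - z) := by
    rw [← circleIntegral.integral_add]
    · refine circleIntegral.integral_congr zero_le_one fun t ht => ?_
      simp only [heq t (mem_sphere_zero_iff_norm.1 ht), add_div]
    · refine circleIntegrable_div_sub zero_le_one hz.ne' ?_
      exact continuousOn_sphere_of_differentiableAt fun t ht => hQ t (by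
        rw [sub_zero] at ht; linarith) (by rw [sub_zero] at ht; linarith)
    · refine circleIntegrable_div_sub zero_le_one hz.ne' ?_
      exact continuousOn_sphere_of_differentiableAt fun t ht => hH t (by
        rw [sub_zero] at ht; linarith)
  rw [← h3]
  linear_combination h2 - h1 - h4

/-- At an interior point it is `H`, vanishing at infinity, that drops out. -/
theorem circleIntegral_eq_of_interior (h : IsFactorization D E d ρ) (hρr : ρ < r) (hr : r < 1)
    (hG : ∀ z, ‖z‖ ≤ 1 → DifferentiableAt ℂ G z)
    (hH : ∀ z, 1 ≤ ‖z‖ → DifferentiableAt ℂ H z) (hH0 : Tendsto H (cobounded ℂ) (𝓝 0))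
    (heq : ∀ z, ‖z‖ = 1 → P.eval z / E z = z ^ n * (D z / E z) * G z + H z)
    {z : ℂ} (hz : ‖z‖ < r) :
    (∮ t in C(0, r), t ^ n * (D t / E t) * G t / (t - z)) = 2 * π * I * (P.eval z / E z) := by
  have hz1 : ‖z‖ < 1 := hz.trans hr
  have hQ : ∀ t, r ≤ ‖t‖ → ‖t‖ ≤ 1 →
      DifferentiableAt ℂ (fun t => t ^ n * (D t / E t) * G t) t := fun t h1 h2 =>
    ((differentiableAt_pow n).mul ((h.diff_ext t (by linarith)).div
      (h.diff_int t (by linarith [h.one_lt_inv])) (h.int_ne_zero t h2))).mul (hG t h2)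
  have hPE : ∀ t, ‖t‖ ≤ 1 → DifferentiableAt ℂ (fun t => P.eval t / E t) t := fun t ht =>
    P.differentiableAt.div (h.diff_int t (by linarith [h.one_lt_inv])) (h.int_ne_zero t ht)
  have h1 := circleIntegral_div_sub_of_exterior hz1 hH hH0
  have h2 := circleIntegral_div_sub_of_disc hz1 hPE
  have h3 := circleIntegral_eq_of_annulus (f := fun t => t ^ n * (D t / E t) * G t / (t - z))
    (c := 0) (h.pos.trans hρr) hr.le fun t ht ht1 => by
      rw [sub_zero] at ht ht1
      exact (hQ t ht ht1).div (by fun_prop) (sub_ne_zero.2 (ne_of_norm_ne (by linarith)))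
  have h4 : (∮ t in C(0, 1), P.eval t / E t / (t - z)) =
      (∮ t in C(0, 1), t ^ n * (D t / E t) * G t / (t - z)) + ∮ t in C(0, 1), H t / (t - z) := by
    rw [← circleIntegral.integral_add]
    · refine circleIntegral.integral_congr zero_le_one fun t ht => ?_
      simp only [heq t (mem_sphere_zero_iff_norm.1 ht), add_div]
    · refine circleIntegrable_div_sub zero_le_one hz1.ne ?_
      exact continuousOn_sphere_of_differentiableAt fun t ht => hQ t (by
        rw [sub_zero] at ht; linarith) (by rw [sub_zero] at ht; linarith)
    · refine circleIntegrable_div_sub zero_le_one hz1.ne ?_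
      exact continuousOn_sphere_of_differentiableAt fun t ht => hH t (by
        rw [sub_zero] at ht; linarith)
  rw [← h3]
  linear_combination h2 - h1 - h4

/-- Divide the boundary relation by `z^n D / E`: now `P / (z^n D)` is holomorphic outside with limit
`1 / d`, because `P` is monic of degree `n`. The contour expands to `|t| = 1/r`, where `t^(-n)` has
size `r^n`. -/
theorem circleIntegral_eq_sub (h : IsFactorization D E d ρ) (hρr : ρ < r) (hr : r < 1)
    (hP : P.Monic) (hn : P.natDegree = n)
    (hG : ∀ z, ‖z‖ ≤ 1 → DifferentiableAt ℂ G z) (hH : ∀ z, 1 ≤ ‖z‖ → DifferentiableAt ℂ H z)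
    (heq : ∀ z, ‖z‖ = 1 → P.eval z / E z = z ^ n * (D z / E z) * G z + H z)
    {z : ℂ} (hz : ‖z‖ < 1) :
    (∮ t in C(0, r⁻¹), H t * (E t / D t) / t ^ n / (t - z)) = 2 * π * I * (d⁻¹ - G z) := by
  have hr0 : 0 < r := h.pos.trans hρr
  have hne : ∀ t : ℂ, 1 ≤ ‖t‖ → t ^ n ≠ 0 := fun t ht =>
    pow_ne_zero _ (norm_pos_iff.1 (by linarith))
  have hV : ∀ t, 1 ≤ ‖t‖ → ‖t‖ ≤ r⁻¹ →
      DifferentiableAt ℂ (fun t => H t * (E t / D t) / t ^ n) t := fun t h1 h2 =>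
    ((hH t h1).mul ((h.diff_int t (h2.trans_lt ((inv_lt_inv₀ hr0 h.pos).2 hρr))).div
      (h.diff_ext t (by linarith [h.lt_one])) (h.ext_ne_zero t h1))).div (differentiableAt_pow n)
      (hne t h1)
  have hPD : ∀ t, 1 ≤ ‖t‖ → DifferentiableAt ℂ (fun t => P.eval t / t ^ n / D t) t := fun t ht =>
    (P.differentiableAt.div (differentiableAt_pow n) (hne t ht)).div
      (h.diff_ext t (by linarith [h.lt_one])) (h.ext_ne_zero t ht)
  have hlim : Tendsto (fun t => P.eval t / t ^ n / D t) (cobounded ℂ) (𝓝 (d⁻¹)) := by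
    have := (tendsto_eval_div_pow hP).div h.tendsto h.limit_ne_zero
    rwa [hn, one_div] at this
  have hrinv : 1 < r⁻¹ := (one_lt_inv₀ hr0).2 hr
  have h1 := circleIntegral_div_sub_of_exterior hz hPD hlim
  have h2 := circleIntegral_div_sub_of_disc hz hG
  have h3 := circleIntegral_eq_of_annulus (f := fun t => H t * (E t / D t) / t ^ n / (t - z))
    (c := 0) one_pos hrinv.le fun t ht ht1 => by
      rw [sub_zero] at ht ht1
      exact (hV t ht ht1).div (by fun_prop) (sub_ne_zero.2 (ne_of_norm_ne (by linarith)))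
  have h4 : (∮ t in C(0, 1), P.eval t / t ^ n / D t / (t - z)) =
      (∮ t in C(0, 1), G t / (t - z)) +
        ∮ t in C(0, 1), H t * (E t / D t) / t ^ n / (t - z) := by
    rw [← circleIntegral.integral_add]
    · refine circleIntegral.integral_congr zero_le_one fun t ht => ?_
      have ht1 := mem_sphere_zero_iff_norm.1 ht
      have hE := h.int_ne_zero t ht1.le
      have hD := h.ext_ne_zero t ht1.ge
      have h5 := heq t ht1
      have h6 : P.eval t = E t * (t ^ n * (D t / E t) * G t + H t) := by
        rw [← h5]
        field_simp
      have h7 := hne t ht1.ge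
      simp only [h6]
      rw [← add_div]
      congr 1
      field_simp
    · refine circleIntegrable_div_sub zero_le_one hz.ne ?_
      exact continuousOn_sphere_of_differentiableAt fun t ht => hG t (by
        rw [sub_zero] at ht; linarith)
    · refine circleIntegrable_div_sub zero_le_one hz.ne ?_
      exact continuousOn_sphere_of_differentiableAt fun t ht => hV t (by
        rw [sub_zero] at ht; linarith) (by rw [sub_zero] at ht; linarith)
  rw [h3]
  linear_combination h1 - h2 - h4

end Splitting

/-- The correction factor `G` of the orthogonal polynomial satisfies a contraction estimate. -/
theorem exists_correction (h : IsFactorization D E d ρ) {r : ℝ} (hρr : ρ < r) (hr : r < 1) :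
    ∃ K : ℝ, ∀ (n : ℕ) (P : ℂ[X]), P.Monic → P.natDegree = n →
      (∀ k < n, (∮ t in C(0, 1), P.eval t / (D t * E t) / t ^ (k + 1)) = 0) →
      ∃ (G : ℂ → ℂ) (γ : ℝ), ContinuousOn G (sphere 0 r) ∧ 0 ≤ γ ∧
        (∀ z, ‖z‖ = r → ‖G z - d⁻¹‖ ≤ γ) ∧ γ ≤ K * r ^ (2 * n) * (‖d⁻¹‖ + γ) ∧
        ∀ z, ‖z‖ < r → (∮ t in C(0, r), t ^ n * (D t / E t) * G t / (t - z)) =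
          2 * π * I * (P.eval z / E z) := by
  have hr0 : 0 < r := h.pos.trans hρr
  have hrinv : 1 < r⁻¹ := (one_lt_inv₀ hr0).2 hr
  have hrρ : r⁻¹ < ρ⁻¹ := (inv_lt_inv₀ hr0 h.pos).2 hρr
  have hδ : 0 < r⁻¹ - r := by linarith
  obtain ⟨M₁, hM₁⟩ := (isCompact_sphere (0 : ℂ) r).exists_bound_of_continuousOn
    (f := fun t => D t / E t) (continuousOn_sphere_of_differentiableAt fun t ht => by
      rw [sub_zero] at ht
      exact (h.diff_ext t (by linarith)).div (h.diff_int t (by linarith))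
        (h.int_ne_zero t (by linarith)))
  obtain ⟨M₂, hM₂⟩ := (isCompact_sphere (0 : ℂ) r⁻¹).exists_bound_of_continuousOn
    (f := fun t => E t / D t) (continuousOn_sphere_of_differentiableAt fun t ht => by
      rw [sub_zero] at ht
      exact (h.diff_int t (by linarith)).div (h.diff_ext t (by linarith))
        (h.ext_ne_zero t (by linarith)))
  -- Two Cauchy transforms between the circles of radii `r` and `r⁻¹`, each with kernel at most `1 /
  -- (r⁻¹ - r)`; the contour lengths contribute `r` and `r⁻¹`, which cancel.
  refine ⟨M₁ * M₂ / (r⁻¹ - r) ^ 2, fun n P hP hn horth => ?_⟩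
  obtain ⟨G, H, hG, hH, hH0, heq⟩ := h.exists_splitting horth
  have hGc : ContinuousOn G (sphere 0 r) := continuousOn_sphere_of_differentiableAt fun t ht => by
    rw [sub_zero] at ht
    exact hG t (by linarith)
  obtain ⟨z₀, hz₀, hmax⟩ := (isCompact_sphere (0 : ℂ) r).exists_isMaxOn
    (NormedSpace.sphere_nonempty.2 hr0.le) (hGc.sub continuousOn_const (g := fun _ => d⁻¹)).norm
  set γ := ‖G z₀ - d⁻¹‖ with hγ
  have hγle : ∀ z, ‖z‖ = r → ‖G z - d⁻¹‖ ≤ γ := fun z hz =>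
    hmax (mem_sphere_zero_iff_norm.2 hz)
  refine ⟨G, γ, hGc, norm_nonneg _, hγle, ?_, fun z hz =>
    h.circleIntegral_eq_of_interior hρr hr hG hH hH0 heq hz⟩
  have h2π : ‖(2 * π * I : ℂ)‖ = 2 * π := by simp [Real.pi_pos.le]
  have hGle : ∀ z, ‖z‖ = r → ‖G z‖ ≤ ‖d⁻¹‖ + γ := fun z hz => by
    have := norm_add_le (d⁻¹) (G z - d⁻¹)
    rw [add_sub_cancel] at this
    linarith [hγle z hz]
  have hHle : ∀ z, ‖z‖ = r⁻¹ → ‖H z‖ ≤ r * (r ^ n * M₁ * (‖d⁻¹‖ + γ) / (r⁻¹ - r)) := by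
    intro z hz
    have h1 := h.circleIntegral_eq_of_exterior hρr hr hG hH hH0 heq (z := z) (by linarith)
    have h2 := norm_circleIntegral_div_sub_le (f := fun t => t ^ n * (D t / E t) * G t) (z := z)
      (B := r ^ n * M₁ * (‖d⁻¹‖ + γ)) hr0.le hδ (fun t ht => by
        have h3 := hM₁ t (mem_sphere_zero_iff_norm.2 ht)
        have h4 := (norm_nonneg _).trans h3
        rw [norm_mul, norm_mul, norm_pow, ht]
        gcongr
        exact hGle t ht) fun t ht => by
        have := norm_sub_norm_le z t
        rw [norm_sub_rev] at this
        linarith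
    rw [h1, norm_mul, h2π] at h2
    have hpi := Real.two_pi_pos
    refine le_of_mul_le_mul_left ?_ hpi
    linarith
  have hz₀r : ‖z₀‖ = r := mem_sphere_zero_iff_norm.1 hz₀
  have h1 := h.circleIntegral_eq_sub hρr hr hP hn hG hH heq (z := z₀) (by linarith)
  have h2 := norm_circleIntegral_div_sub_le (f := fun t => H t * (E t / D t) / t ^ n) (z := z₀)
    (B := r * (r ^ n * M₁ * (‖d⁻¹‖ + γ) / (r⁻¹ - r)) * M₂ * r ^ n) (inv_pos.2 hr0).le hδ
    (fun t ht => by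
      have h3 := hM₂ t (mem_sphere_zero_iff_norm.2 ht)
      have h4 := hHle t ht
      have h5 := (norm_nonneg _).trans h4
      rw [norm_div, norm_mul, norm_pow, ht, inv_pow, div_inv_eq_mul]
      gcongr) fun t ht => by
      have := norm_sub_norm_le t z₀
      linarith
  rw [h1, norm_mul, h2π, norm_sub_rev, ← hγ] at h2
  refine le_of_mul_le_mul_left (h2.trans (le_of_eq ?_)) Real.two_pi_pos
  rw [two_mul n, pow_add]
  field_simp

theorem exists_correction_bound (h : IsFactorization D E d ρ) {r : ℝ} (hρr : ρ < r) (hr : r < 1)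
    {P : ℕ → ℂ[X]} (hP : ∀ n, (P n).Monic) (hn : ∀ n, (P n).natDegree = n)
    (horth : ∀ n, ∀ k < n, (∮ t in C(0, 1), (P n).eval t / (D t * E t) / t ^ (k + 1)) = 0) :
    ∃ (G : ℕ → ℂ → ℂ) (C : ℝ), ∀ n, ContinuousOn (G n) (sphere 0 r) ∧
      (∀ z, ‖z‖ = r → ‖G n z - d⁻¹‖ ≤ C * r ^ (2 * n)) ∧
        ∀ z, ‖z‖ < r → (∮ t in C(0, r), t ^ n * (D t / E t) * G n t / (t - z)) =
          2 * π * I * ((P n).eval z / E z) := by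
  have hr0 : 0 < r := h.pos.trans hρr
  obtain ⟨K, hK⟩ := h.exists_correction hρr hr
  choose G γ hGc hγ0 hγ hγK hint using fun n => hK n (P n) (hP n) (hn n) (horth n)
  have hlim : Tendsto (fun n : ℕ => K * r ^ (2 * n)) atTop (𝓝 0) := by
    have h1 := (tendsto_pow_atTop_nhds_zero_of_lt_one (sq_nonneg r)
      (show r ^ 2 < 1 by nlinarith)).const_mul K
    simpa only [mul_zero, ← pow_mul] using h1
  have hbdd : BddAbove (range fun n => γ n / r ^ (2 * n)) := by
    refine IsBoundedUnder.bddAbove_range ⟨2 * |K| * ‖d⁻¹‖, ?_⟩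
    rw [eventually_map]
    filter_upwards [hlim.eventually (gt_mem_nhds (show (0 : ℝ) < 1 / 2 by norm_num))] with n hn2
    have h1 := hγK n
    have h2 : γ n ≤ 2 * (K * r ^ (2 * n) * ‖d⁻¹‖) := by nlinarith [hγ0 n]
    rw [div_le_iff₀ (by positivity)]
    refine h2.trans ?_
    have h3 : K * r ^ (2 * n) * ‖d⁻¹‖ ≤ |K| * r ^ (2 * n) * ‖d⁻¹‖ := by
      gcongr
      exact le_abs_self K
    linarith
  obtain ⟨C, hC⟩ := hbdd
  refine ⟨G, C, fun n => ⟨hGc n, fun z hz => (hγ n z hz).trans ?_, hint n⟩⟩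
  have := hC (mem_range_self n)
  rwa [div_le_iff₀ (by positivity)] at this

end IsFactorization

/-! ### Asymptotics of the orthogonal polynomials -/

theorem exists_eq_circle_exp {z : ℂ} (hz : ‖z‖ = 1) : ∃ θ : ℝ, z = (Circle.exp θ : ℂ) :=
  ⟨z.arg, by
    have := Circle.exp_arg ⟨z, mem_sphere_zero_iff_norm.2 hz⟩
    exact (congrArg Subtype.val this).symm⟩

section Continuation

variable {w : Circle → ℝ} {ρ' : ℝ} {A : Finset ℂ} {De : ℂ → ℂ}

theorem IsExteriorContinuation.differentiableAt_of_notMem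
    (hDe : IsExteriorContinuation w De ({z : ℂ | ρ' < ‖z‖} \ (A : Set ℂ))) {z : ℂ}
    (hz : ρ' < ‖z‖) (hzA : z ∉ A) : DifferentiableAt ℂ De z :=
  hDe.differentiableOn.differentiableAt
    (((isOpen_lt continuous_const continuous_norm).sdiff A.finite_toSet.isClosed).mem_nhds
      ⟨hz, by simpa using hzA⟩)

/-- Off the circle the factors do not vanish because they are exponentials or their inverses; on it,
because `|D_e|² w = 1`. -/
theorem IsExteriorContinuation.isFactorization (hw : IsAnalyticWeight w)
    (hDe : IsExteriorContinuation w De ({z : ℂ | ρ' < ‖z‖} \ (A : Set ℂ))) {ρ : ℝ}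
    (hA : ∀ a ∈ A, ‖a‖ = ρ) (hρ0 : 0 < ρ) (hρ1 : ρ < 1) (hρ' : ρ' < ρ) :
    IsFactorization De (interiorInv w De) (szegoAtInfty w) ρ := by
  have hd : ∀ z, ρ < ‖z‖ → DifferentiableAt ℂ De z := fun z hz =>
    hDe.differentiableAt_of_notMem (hρ'.trans hz) fun h => hz.ne' (hA z h)
  have hne : ∀ θ : ℝ, De (Circle.exp θ : ℂ) ≠ 0 := fun θ h => by
    have := norm_sq_mul_weight hw hDe.eq_szego
      (fun z hz => (hd z (by linarith)).continuousAt) θ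
    rw [h] at this
    simp at this
  refine ⟨hρ0, hρ1, hd, fun z hz => differentiableAt_interiorInv hw hDe.eq_szego hρ0 hd hz,
    fun z hz => ?_, fun z hz => ?_, ?_, szegoAtInfty_ne_zero w⟩
  · rcases hz.eq_or_lt with h | h
    · obtain ⟨θ, rfl⟩ := exists_eq_circle_exp h.symm
      exact hne θ
    · rw [hDe.eq_szego z h]
      exact szegoFunction_ne_zero _ _
  · rcases hz.eq_or_lt with h | h
    · obtain ⟨θ, rfl⟩ := exists_eq_circle_exp h
      rw [interiorInv_exp]
      exact (_root_.map_ne_zero _).2 (hne θ)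
    · rw [interiorInv_of_lt h]
      exact inv_ne_zero (szegoFunction_ne_zero _ _)
  · refine (tendsto_szegoFunction_cobounded hw).congr' ?_
    filter_upwards [eventually_cobounded_le_norm (E := ℂ) 2] with z hz
    exact (hDe.eq_szego z (by linarith)).symm

theorem circleIntegral_orthogonality (hw : IsAnalyticWeight w)
    (hDe : ∀ z, 1 < ‖z‖ → De z = szegoFunction w z) (hc : ∀ z, ‖z‖ = 1 → ContinuousAt De z)
    (n k : ℕ) (hk : k < n) : (∮ t in C(0, 1), (monicOPUC w n).eval t /
      (De t * interiorInv w De t) / t ^ (k + 1)) = 0 := by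
  have h0 := opucInner_monicOPUC hw n (X ^ k) (by
    rw [degree_X_pow]
    exact_mod_cast hk)
  -- On the circle `dt = i t dθ` and `conj (t^k) = t^(-k)`, whence the exponent `k + 1`.
  suffices h : (∮ t in C(0, 1), (monicOPUC w n).eval t / (De t * interiorInv w De t) /
      t ^ (k + 1)) = I * opucInner w (monicOPUC w n) (X ^ k) by rw [h, h0, mul_zero]
  rw [opucInner, circleIntegral, ← intervalIntegral.integral_const_mul]
  congr 1
  ext θ
  have h1 : De (Circle.exp θ : ℂ) * interiorInv w De (Circle.exp θ : ℂ) *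
      (w (Circle.exp θ) : ℂ) = 1 := by
    rw [interiorInv_exp, Complex.mul_conj, Complex.normSq_eq_norm_sq]
    exact_mod_cast norm_sq_mul_weight hw hDe hc θ
  have h2 : (w (Circle.exp θ) : ℂ) ≠ 0 := by exact_mod_cast (hw.pos _).ne'
  have h3 : (Circle.exp θ : ℂ) ≠ 0 := Circle.coe_ne_zero _
  have h4 : conj (Circle.exp θ : ℂ) = (Circle.exp θ : ℂ)⁻¹ := by
    rw [← Circle.coe_inv_eq_conj, Circle.coe_inv]
  simp only [deriv_circleMap, circleMap_zero_one, smul_eq_mul, eval_pow, eval_X, map_pow, h4, inv_pow,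
    eq_inv_of_mul_eq_one_left h1]
  field_simp
  ring

theorem differentiableAt_scattering (hw : IsAnalyticWeight w)
    (hDe : IsExteriorContinuation w De ({z : ℂ | ρ' < ‖z‖} \ (A : Set ℂ))) {z : ℂ}
    (hz : ρ' < ‖z‖) (hz1 : ‖z‖ < 1) (hzA : z ∉ A) : DifferentiableAt ℂ (scattering w De) z :=
  (differentiableAt_szegoFunction hw hz1).mul (hDe.differentiableAt_of_notMem hz hzA)

theorem circleIntegral_scattering_of_lt (hw : IsAnalyticWeight w) (hρ'0 : 0 ≤ ρ')
    (hDe : IsExteriorContinuation w De ({z : ℂ | ρ' < ‖z‖} \ (A : Set ℂ))) {ρ₁ r : ℝ}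
    (hρ₁ : ρ' < ρ₁) (hr : ρ₁ ≤ r) (hr1 : r < 1) (hA : ∀ a ∈ A, ρ₁ < ‖a‖ ∧ ‖a‖ < r) (n : ℕ) {z : ℂ}
    (hz : ‖z‖ < ρ₁) :
    (∮ t in C(0, r), scattering w De t * (t ^ n / (t - z))) =
      (∮ t in C(0, ρ₁), scattering w De t * (t ^ n / (t - z))) +
        2 * π * I * ∑ a ∈ A, residue (fun t => scattering w De t * (t ^ n / (t - z))) a :=
  circleIntegral_annulus_eq_sum_residue (hρ'0.trans_lt hρ₁) hr A _ hA fun t h1 h2 htA =>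
    (differentiableAt_scattering hw hDe (by linarith) (by linarith) htA).mul
      ((differentiableAt_pow n).div (by fun_prop) (sub_ne_zero.2 (ne_of_norm_ne (by linarith))))

/-- Here `t = z` also lies between the two circles; its residue is the source of the term `z^n
D_e(z) / D_e(∞)`. -/
theorem circleIntegral_scattering_of_gt (hw : IsAnalyticWeight w) (hρ'0 : 0 ≤ ρ')
    (hDe : IsExteriorContinuation w De ({z : ℂ | ρ' < ‖z‖} \ (A : Set ℂ))) {ρ₁ r : ℝ}
    (hρ₁ : ρ' < ρ₁) (hr : ρ₁ ≤ r) (hr1 : r < 1) (hA : ∀ a ∈ A, ρ₁ < ‖a‖ ∧ ‖a‖ < r) (n : ℕ) {z : ℂ}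
    (hz : ρ₁ < ‖z‖) (hzr : ‖z‖ < r) (hzA : z ∉ A) :
    (∮ t in C(0, r), scattering w De t * (t ^ n / (t - z))) =
      (∮ t in C(0, ρ₁), scattering w De t * (t ^ n / (t - z))) +
        2 * π * I * (scattering w De z * z ^ n +
          ∑ a ∈ A, residue (fun t => scattering w De t * (t ^ n / (t - z))) a) := by
  classical
  have hres : residue (fun t => scattering w De t * (t ^ n / (t - z))) z =
      scattering w De z * z ^ n := by
    simp only [← mul_div_assoc]
    refine residue_div_sub (f := fun t => scattering w De t * t ^ n) ?_
    have hopen : IsOpen ({t : ℂ | ρ₁ < ‖t‖ ∧ ‖t‖ < r} \ (A : Set ℂ)) :=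
      ((isOpen_lt continuous_const continuous_norm).inter
        (isOpen_lt continuous_norm continuous_const)).sdiff A.finite_toSet.isClosed
    filter_upwards [hopen.mem_nhds ⟨⟨hz, hzr⟩, by simpa using hzA⟩] with t ht
    exact (differentiableAt_scattering hw hDe (hρ₁.trans ht.1.1) (ht.1.2.trans hr1)
      (by simpa using ht.2)).mul (differentiableAt_pow n)
  rw [← hres, ← Finset.sum_insert hzA]
  refine circleIntegral_annulus_eq_sum_residue (hρ'0.trans_lt hρ₁) hr (insert z A) _ ?_ ?_
  · intro b hb
    rcases Finset.mem_insert.1 hb with rfl | hb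
    · exact ⟨hz, hzr⟩
    · exact hA b hb
  · intro t h1 h2 ht
    rw [Finset.mem_insert, not_or] at ht
    exact (differentiableAt_scattering hw hDe (by linarith) (by linarith) ht.2).mul
      ((differentiableAt_pow n).div (by fun_prop) (sub_ne_zero.2 ht.1))

end Continuation

/-- Replaces `G` by `1 / d` in the interior formula. On `|t| = r` the error carries `r^n` from `t^n`
and `r^(2n)` from `G - 1 / d`, hence the exponent `3n`. -/
theorem IsFactorization.exists_main_bound {D E : ℂ → ℂ} {d : ℂ} {ρ : ℝ}
    (h : IsFactorization D E d ρ) {r r' : ℝ} (hρr : ρ < r) (hr : r < 1) (hr' : r' < r)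
    {P : ℕ → ℂ[X]} (hP : ∀ n, (P n).Monic) (hn : ∀ n, (P n).natDegree = n)
    (horth : ∀ n, ∀ k < n, (∮ t in C(0, 1), (P n).eval t / (D t * E t) / t ^ (k + 1)) = 0) :
    ∃ C : ℝ, ∀ (n : ℕ) (z : ℂ), ‖z‖ ≤ r' →
      ‖(P n).eval z - E z * d⁻¹ * ((2 * π * I)⁻¹ *
        ∮ t in C(0, r), D t / E t * (t ^ n / (t - z)))‖ ≤ C * r ^ (3 * n) := by
  have hr0 : 0 < r := h.pos.trans hρr
  obtain ⟨G, C, hG⟩ := h.exists_correction_bound hρr hr hP hn horth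
  have hSc : ContinuousOn (fun t => D t / E t) (sphere 0 r) :=
    continuousOn_sphere_of_differentiableAt fun t ht => by
      rw [sub_zero] at ht
      exact (h.diff_ext t (by linarith)).div (h.diff_int t (by linarith [h.one_lt_inv]))
        (h.int_ne_zero t (by linarith))
  obtain ⟨M, hM⟩ := (isCompact_sphere (0 : ℂ) r).exists_bound_of_continuousOn hSc
  obtain ⟨N, hN⟩ := (isCompact_closedBall (0 : ℂ) 1).exists_bound_of_continuousOn (f := E)
    fun t ht => (h.diff_int t (by
      linarith [h.one_lt_inv, mem_closedBall_zero_iff.1 ht])).continuousAt.continuousWithinAt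
  refine ⟨N * ((2 * π)⁻¹ * (2 * π * r * (M * C / (r - r')))), fun n z hz => ?_⟩
  have hzr : ‖z‖ < r := hz.trans_lt hr'
  have hEz := h.int_ne_zero z (by linarith)
  obtain ⟨hGc, hGb, hGi⟩ := hG n
  have hne : ∀ t ∈ sphere (0 : ℂ) r, t - z ≠ 0 := fun t ht => sub_ne_zero.2 (ne_of_norm_ne (by
    rw [mem_sphere_zero_iff_norm.1 ht]; exact hzr.ne'))
  have h1 : (∮ t in C(0, r), t ^ n * (D t / E t) * (G n t - d⁻¹) / (t - z)) =
      2 * π * I * ((P n).eval z / E z) -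
        d⁻¹ * ∮ t in C(0, r), D t / E t * (t ^ n / (t - z)) := by
    rw [← hGi z hzr, ← circleIntegral.integral_const_mul, ← circleIntegral.integral_sub]
    · refine circleIntegral.integral_congr hr0.le fun t _ => ?_
      ring
    · exact ((((continuousOn_pow n).mul hSc).mul hGc).div (by fun_prop)
        hne).circleIntegrable hr0.le
    · exact (continuousOn_const.mul (hSc.mul ((continuousOn_pow n).div (by fun_prop)
        hne))).circleIntegrable hr0.le
  have h2 : (P n).eval z - E z * d⁻¹ * ((2 * π * I)⁻¹ *
      ∮ t in C(0, r), D t / E t * (t ^ n / (t - z))) = E z * ((2 * π * I)⁻¹ *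
        ∮ t in C(0, r), t ^ n * (D t / E t) * (G n t - d⁻¹) / (t - z)) := by
    rw [h1, mul_sub, inv_mul_cancel_left₀ two_pi_I_ne_zero, mul_sub, mul_div_cancel₀ _ hEz]
    ring
  have hpi : ‖(2 * π * I : ℂ)⁻¹‖ = (2 * π)⁻¹ := by simp [Real.pi_pos.le]
  have h3 := norm_circleIntegral_div_sub_le (z := z)
    (f := fun t => t ^ n * (D t / E t) * (G n t - d⁻¹)) (B := r ^ n * M * (C * r ^ (2 * n)))
    hr0.le (sub_pos.2 hr') (fun t ht => by
      have h4 := hM t (mem_sphere_zero_iff_norm.2 ht)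
      have h5 := (norm_nonneg _).trans h4
      rw [norm_mul, norm_mul, norm_pow, ht]
      gcongr
      exact hGb t ht) fun t ht => by
      have := norm_sub_norm_le t z
      linarith
  have hN0 := hN z (mem_closedBall_zero_iff.2 (by linarith))
  have hN1 := (norm_nonneg _).trans hN0
  rw [h2, norm_mul, norm_mul, hpi]
  refine (mul_le_mul hN0 (mul_le_mul_of_nonneg_left h3 (by positivity)) (by positivity)
    hN1).trans (le_of_eq ?_)
  have : r ^ (3 * n) = r ^ n * r ^ (2 * n) := by
    rw [← pow_add]
    congr 1
    ring
  rw [this]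
  ring

/-! ### Shrinking the contour below the critical radius -/

section Estimates

variable {w : Circle → ℝ} {ρ ρ' r r' : ℝ} {A : Finset ℂ} {De : ℂ → ℂ}

/-- Moving the contour of integration to a circle of radius less than the critical one. -/
theorem exists_contour_bound (hw : IsAnalyticWeight w) (hρ'0 : 0 ≤ ρ') (hρ' : ρ' < ρ)
    (hA : ∀ a ∈ A, ‖a‖ = ρ)
    (hDe : IsExteriorContinuation w De ({z : ℂ | ρ' < ‖z‖} \ (A : Set ℂ)))
    (hρr : ρ < r) (hr : r < 1) (hr' : r' < r) {ρ₁ δ : ℝ} (hρ₁ : ρ' < ρ₁) (hρ₁ρ : ρ₁ < ρ)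
    (hδ : 0 < δ) :
    ∃ C : ℝ, 0 ≤ C ∧ ∀ (n : ℕ) (z : ℂ), ‖z‖ ≤ r' → (∀ t : ℂ, ‖t‖ = ρ₁ → δ ≤ ‖t - z‖) →
      ‖(monicOPUC w n).eval z - szegoFunction w 0 / szegoFunction w z * ((2 * π * I)⁻¹ *
        ((∮ t in C(0, r), scattering w De t * (t ^ n / (t - z))) -
          ∮ t in C(0, ρ₁), scattering w De t * (t ^ n / (t - z))))‖
        ≤ C * (ρ₁ ^ n + r ^ (3 * n)) := by
  have hρ0 : 0 < ρ := hρ'0.trans_lt hρ'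
  have hρ₁0 : 0 < ρ₁ := hρ'0.trans_lt hρ₁
  have hr0 : 0 < r := hρ0.trans hρr
  have hfac := hDe.isFactorization hw hA hρ0 (hρr.trans hr) hρ'
  obtain ⟨C, hC⟩ := hfac.exists_main_bound hρr hr hr' (fun n => monicOPUC_monic w n)
    (fun n => natDegree_monicOPUC w n) (fun n k hk => circleIntegral_orthogonality hw hDe.eq_szego
      (fun z hz => (hfac.diff_ext z (by linarith)).continuousAt) n k hk)
  obtain ⟨M, hM⟩ := (isCompact_sphere (0 : ℂ) ρ₁).exists_bound_of_continuousOn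
    (f := scattering w De) (continuousOn_sphere_of_differentiableAt fun t ht => by
      rw [sub_zero] at ht
      exact differentiableAt_scattering hw hDe (by linarith) (by linarith) fun h => by
        linarith [hA t h])
  obtain ⟨N, hN⟩ := (isCompact_closedBall (0 : ℂ) r).exists_bound_of_continuousOn
    (f := fun z => szegoFunction w 0 / szegoFunction w z) fun t ht =>
      ((differentiableAt_const _).div (differentiableAt_szegoFunction hw (by
        linarith [mem_closedBall_zero_iff.1 ht]))
        (szegoFunction_ne_zero w t)).continuousAt.continuousWithinAt
  set C₂ := N * ((2 * π)⁻¹ * (2 * π * ρ₁ * (M / δ))) with hC₂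
  refine ⟨|C| + |C₂|, by positivity, fun n z hz hzδ => ?_⟩
  have hzr : ‖z‖ < r := hz.trans_lt hr'
  have hE : interiorInv w De z * (szegoAtInfty w)⁻¹ =
      szegoFunction w 0 / szegoFunction w z := by
    rw [interiorInv_of_lt (by linarith), szegoFunction_zero]
    ring
  have hint : (∮ t in C(0, r), De t / interiorInv w De t * (t ^ n / (t - z))) =
      ∮ t in C(0, r), scattering w De t * (t ^ n / (t - z)) :=
    circleIntegral.integral_congr hr0.le fun t ht => by
      simp only [scattering]
      rw [interiorInv_of_lt (by rw [mem_sphere_zero_iff_norm.1 ht]; exact hr), div_inv_eq_mul,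
        mul_comm (De t)]
  have h1 := hC n z hz
  rw [hE, hint] at h1
  have hpi : ‖(2 * π * I : ℂ)⁻¹‖ = (2 * π)⁻¹ := by simp [Real.pi_pos.le]
  have h2 : ‖szegoFunction w 0 / szegoFunction w z * ((2 * π * I)⁻¹ *
      ∮ t in C(0, ρ₁), scattering w De t * (t ^ n / (t - z)))‖ ≤ C₂ * ρ₁ ^ n := by
    have h3 := norm_circleIntegral_div_sub_le (f := fun t => scattering w De t * t ^ n) (z := z)
      (B := M * ρ₁ ^ n) hρ₁0.le hδ (fun t ht => by
        rw [norm_mul, norm_pow, ht]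
        gcongr
        exact hM t (mem_sphere_zero_iff_norm.2 ht)) hzδ
    simp only [mul_div_assoc] at h3
    have hN0 := hN z (mem_closedBall_zero_iff.2 hzr.le)
    rw [norm_mul, norm_mul, hpi]
    refine (mul_le_mul hN0 (mul_le_mul_of_nonneg_left h3 (by positivity)) (by positivity)
      ((norm_nonneg _).trans hN0)).trans (le_of_eq ?_)
    rw [hC₂]
    ring
  have h3 : ∀ p q x y : ℂ, p - q * (x - y) = (p - q * x) + q * y := fun p q x y => by ring
  rw [mul_sub, h3]
  refine (norm_add_le _ _).trans ((add_le_add h1 h2).trans ?_)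
  have h4 : C * r ^ (3 * n) ≤ |C| * r ^ (3 * n) := by
    gcongr
    exact le_abs_self C
  have h5 : C₂ * ρ₁ ^ n ≤ |C₂| * ρ₁ ^ n := by
    gcongr
    exact le_abs_self C₂
  have h6 : 0 ≤ |C| * ρ₁ ^ n := by positivity
  have h7 : 0 ≤ |C₂| * r ^ (3 * n) := by positivity
  linarith

theorem exists_bound_inside (hw : IsAnalyticWeight w) (hρ'0 : 0 ≤ ρ') (hρ' : ρ' < ρ)
    (hA : ∀ a ∈ A, ‖a‖ = ρ)
    (hDe : IsExteriorContinuation w De ({z : ℂ | ρ' < ‖z‖} \ (A : Set ℂ)))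
    (hρr : ρ < r) (hr : r < 1) {ρ₁ κ : ℝ} (hρ₁ : ρ' < ρ₁) (hρ₁ρ : ρ₁ < ρ) (hκ : κ < ρ₁) :
    ∃ C : ℝ, 0 ≤ C ∧ ∀ (n : ℕ) (z : ℂ), ‖z‖ ≤ κ →
      ‖(monicOPUC w n).eval z - residueTerm w De A n z‖ ≤ C * (ρ₁ ^ n + r ^ (3 * n)) := by
  obtain ⟨C, hC0, hC⟩ := exists_contour_bound hw hρ'0 hρ' hA hDe hρr hr
    (show κ < r by linarith) hρ₁ hρ₁ρ (sub_pos.2 hκ)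
  refine ⟨C, hC0, fun n z hz => ?_⟩
  have h1 := hC n z hz fun t ht => by
    have := norm_sub_norm_le t z
    linarith
  rw [circleIntegral_scattering_of_lt hw hρ'0 hDe hρ₁ (by linarith) hr
    (fun a ha => by rw [hA a ha]; exact ⟨hρ₁ρ, hρr⟩) n (by linarith), add_sub_cancel_left,
    inv_mul_cancel_left₀ two_pi_I_ne_zero] at h1
  exact h1

theorem exists_bound_outside (hw : IsAnalyticWeight w) (hρ'0 : 0 ≤ ρ') (hρ' : ρ' < ρ)
    (hA : ∀ a ∈ A, ‖a‖ = ρ)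
    (hDe : IsExteriorContinuation w De ({z : ℂ | ρ' < ‖z‖} \ (A : Set ℂ)))
    (hρr : ρ < r) (hr : r < 1) (hr' : r' < r) {ρ₁ s : ℝ} (hρ₁ : ρ' < ρ₁) (hρ₁ρ : ρ₁ < ρ)
    (hs : ρ₁ < s) :
    ∃ C : ℝ, 0 ≤ C ∧ ∀ (n : ℕ) (z : ℂ), s ≤ ‖z‖ → ‖z‖ ≤ r' → z ∉ A →
      ‖(monicOPUC w n).eval z - z ^ n * (De z / szegoAtInfty w) - residueTerm w De A n z‖
        ≤ C * (ρ₁ ^ n + r ^ (3 * n)) := by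
  obtain ⟨C, hC0, hC⟩ := exists_contour_bound hw hρ'0 hρ' hA hDe hρr hr hr' hρ₁ hρ₁ρ
    (sub_pos.2 hs)
  refine ⟨C, hC0, fun n z hsz hz hzA => ?_⟩
  have h1 := hC n z hz fun t ht => by
    have := norm_sub_norm_le z t
    rw [norm_sub_rev] at this
    linarith
  rw [circleIntegral_scattering_of_gt hw hρ'0 hDe hρ₁ (by linarith) hr
    (fun a ha => by rw [hA a ha]; exact ⟨hρ₁ρ, hρr⟩) n (by linarith) (by linarith) hzA,
    add_sub_cancel_left, inv_mul_cancel_left₀ two_pi_I_ne_zero] at h1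
  -- `D_i(z)` cancels against `𝒮(z) = D_i(z) D_e(z)`, and `D_i(0) = 1 / D_e(∞)`.
  have h2 : szegoFunction w 0 / szegoFunction w z * (scattering w De z * z ^ n) =
      z ^ n * (De z / szegoAtInfty w) := by
    have := szegoFunction_ne_zero w z
    rw [scattering, szegoFunction_zero]
    field_simp
  rwa [mul_add, h2, ← sub_sub] at h1

theorem pow_eq_pow_mul_div_pow {x y : ℝ} (hy : y ≠ 0) (n : ℕ) : x ^ n = y ^ n * (x / y) ^ n := by
  rw [← mul_pow, mul_div_cancel₀ _ hy]

end Estimates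

end Szego


/-! ### Choice of the radii and of `δ` -/

theorem mainTheorem2 (w : Circle → ℝ) (hw : Szego.IsAnalyticWeight w)
    (ρ' : ℝ) (hρ'0 : 0 ≤ ρ') (hρ' : ρ' < Szego.criticalRadius w)
    (A : Finset ℂ) (hA : ∀ a ∈ A, ‖a‖ = Szego.criticalRadius w)
    (De : ℂ → ℂ) (hDe : Szego.IsExteriorContinuation w De ({z : ℂ | ρ' < ‖z‖} \ (A : Set ℂ)))
    (r : ℝ) (hρr : Szego.criticalRadius w < r) (hr : r < 1) :
    (∀ r' : ℝ, Szego.criticalRadius w < r' → r' < r →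
      (∀ s : ℝ, ρ' < s →
        ∃ δ C : ℝ, 0 ≤ δ ∧ δ < 1 ∧ ∀ (n : ℕ) (z : ℂ), s ≤ ‖z‖ → ‖z‖ ≤ r' → z ∉ A →
          ‖(Szego.monicOPUC w n).eval z - z ^ n * (De z / Szego.szegoAtInfty w)
              - Szego.residueTerm w De A n z‖
            ≤ C * (Szego.criticalRadius w ^ n * δ ^ n + r ^ (3 * n))) ∧
      ((∃ s M : ℝ, ρ' < s ∧ ∀ z : ℂ, ρ' < ‖z‖ → ‖z‖ < s → ‖De z‖ ≤ M) →
        ∃ δ C : ℝ, 0 ≤ δ ∧ δ < 1 ∧ ∀ (n : ℕ) (z : ℂ), ρ' < ‖z‖ → ‖z‖ ≤ r' → z ∉ A →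
          ‖(Szego.monicOPUC w n).eval z - z ^ n * (De z / Szego.szegoAtInfty w)
              - Szego.residueTerm w De A n z‖
            ≤ C * (Szego.criticalRadius w ^ n * δ ^ n + r ^ (3 * n)))) ∧
    (∀ K : Set ℂ, IsCompact K → K ⊆ Metric.ball 0 (Szego.criticalRadius w) →
      ∃ δ C : ℝ, 0 ≤ δ ∧ δ < 1 ∧ ∀ (n : ℕ) (z : ℂ), z ∈ K →
        ‖(Szego.monicOPUC w n).eval z - Szego.residueTerm w De A n z‖
          ≤ C * (Szego.criticalRadius w ^ n * δ ^ n + r ^ (3 * n))) := by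
  set ρ := Szego.criticalRadius w
  have hρ0 : 0 < ρ := hρ'0.trans_lt hρ'
  have hr0 : 0 < r := hρ0.trans hρr
  refine ⟨fun r' _ hr' => ⟨fun s hs => ?_, ?_⟩, fun K hK hKρ => ?_⟩
  · obtain ⟨ρ₁, hρ₁, hρ₁'⟩ := exists_between (lt_min hs hρ')
    have hρ₁ρ : ρ₁ < ρ := hρ₁'.trans_le (min_le_right _ _)
    obtain ⟨C, -, hC⟩ := Szego.exists_bound_outside hw hρ'0 hρ' hA hDe hρr hr hr' hρ₁ hρ₁ρ
      (hρ₁'.trans_le (min_le_left _ _))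
    refine ⟨ρ₁ / ρ, C, by have := hρ'0.trans_lt hρ₁; positivity, (div_lt_one hρ0).2 hρ₁ρ, ?_⟩
    simpa only [← Szego.pow_eq_pow_mul_div_pow hρ0.ne'] using hC
  · rintro ⟨s, M, hs, hM⟩
    obtain ⟨ρ₁, hρ₁, hρ₁'⟩ := exists_between (lt_min hs hρ')
    have hρ₁ρ : ρ₁ < ρ := hρ₁'.trans_le (min_le_right _ _)
    have hρ₁s : ρ₁ < s := hρ₁'.trans_le (min_le_left _ _)
    -- The radii satisfy `ρ' < ρ₁ < s₁ < ρ₂ < ρ` and `s₁ < s`. Points with `|z| ≥ s₁` stay away from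
    -- the contour `ρ₁`, points with `|z| < s₁` from the contour `ρ₂`, so every `z` is served by one
    -- of two fixed contours.
    obtain ⟨s₁, hs₁, hs₁'⟩ := exists_between (lt_min hρ₁s hρ₁ρ)
    have hs₁ρ : s₁ < ρ := hs₁'.trans_le (min_le_right _ _)
    have hs₁s : s₁ < s := hs₁'.trans_le (min_le_left _ _)
    obtain ⟨ρ₂, hρ₂, hρ₂ρ⟩ := exists_between hs₁ρ
    have hρ₁0 : 0 < ρ₁ := hρ'0.trans_lt hρ₁
    have hρ₂0 : 0 < ρ₂ := by linarith
    obtain ⟨C₁, hC₁0, hC₁⟩ := Szego.exists_bound_outside hw hρ'0 hρ' hA hDe hρr hr hr' hρ₁ hρ₁ρ hs₁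
    obtain ⟨C₂, hC₂0, hC₂⟩ := Szego.exists_bound_inside hw hρ'0 hρ' hA hDe hρr hr
      (show ρ' < ρ₂ by linarith) hρ₂ρ hρ₂
    refine ⟨ρ₂ / ρ, C₁ + C₂ + |M| / ‖Szego.szegoAtInfty w‖, by positivity,
      (div_lt_one hρ0).2 hρ₂ρ, fun n z hz hzr hzA => ?_⟩
    rw [← Szego.pow_eq_pow_mul_div_pow hρ0.ne']
    have hX : 0 ≤ ρ₂ ^ n + r ^ (3 * n) := by positivity
    have hM0 : 0 ≤ |M| / ‖Szego.szegoAtInfty w‖ := by positivity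
    rcases le_or_gt s₁ ‖z‖ with h | h
    · have h1 : ρ₁ ^ n + r ^ (3 * n) ≤ ρ₂ ^ n + r ^ (3 * n) := by
        have : ρ₁ ≤ ρ₂ := by linarith
        gcongr
      refine (hC₁ n z h hzr hzA).trans ?_
      refine (mul_le_mul_of_nonneg_left h1 hC₁0).trans ?_
      gcongr
      linarith
    -- The contour `ρ₂` encloses `z`, so no term `z^n D_e(z) / D_e(∞)` arises; since `De` is bounded
    -- here, that term is itself `O(ρ₂^n)`.
    · rw [sub_right_comm]
      refine (norm_sub_le _ _).trans ?_
      have h1 := hC₂ n z h.le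
      have h2 : ‖z ^ n * (De z / Szego.szegoAtInfty w)‖ ≤
          |M| / ‖Szego.szegoAtInfty w‖ * ρ₂ ^ n := by
        rw [norm_mul, norm_pow, norm_div, mul_comm]
        have h3 : ‖z‖ ≤ ρ₂ := by linarith
        have h4 : ‖De z‖ ≤ |M| := (hM z hz (h.trans hs₁s)).trans (le_abs_self M)
        gcongr
      have h5 : 0 ≤ |M| / ‖Szego.szegoAtInfty w‖ * r ^ (3 * n) := by positivity
      have h6 : 0 ≤ C₁ * (ρ₂ ^ n + r ^ (3 * n)) := by positivity
      linarith
  · obtain ⟨κ, hκ, hKκ⟩ : ∃ κ < ρ, ∀ z ∈ K, ‖z‖ ≤ κ := by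
      obtain ⟨e, he, h⟩ := hK.exists_forall_le' (f := fun z : ℂ => ρ - ‖z‖) (by fun_prop) (a := 0)
        fun z hz => sub_pos.2 (mem_ball_zero_iff.1 (hKρ hz))
      exact ⟨ρ - e, by linarith, fun z hz => by linarith [h z hz]⟩
    -- The contour must enclose `K` and stay where `De` is defined.
    obtain ⟨ρ₁, hρ₁, hρ₁ρ⟩ := exists_between (max_lt hκ hρ')
    have hρ₁' : ρ' < ρ₁ := (le_max_right _ _).trans_lt hρ₁
    obtain ⟨C, -, hC⟩ := Szego.exists_bound_inside hw hρ'0 hρ' hA hDe hρr hr hρ₁' hρ₁ρ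
      ((le_max_left _ _).trans_lt hρ₁)
    refine ⟨ρ₁ / ρ, C, by have := hρ'0.trans_lt hρ₁'; positivity, (div_lt_one hρ0).2 hρ₁ρ,
      fun n z hz => ?_⟩
    rw [← Szego.pow_eq_pow_mul_div_pow hρ0.ne']
    exact hC n z (hKκ z hz)
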